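/- All intervals are finite posets with a least element $\hat 0$ and a greatest element $\hat 1$. A *hereditary family* $(\mathcal P,\sim,\cdot)$ is a nonempty set $\mathcal P$ of intervals, closed under taking subintervals, with a product $\mathcal P\times\mathcal P\to\mathcal P$, $(P,Q)\mapsto PQ$, and an equivalence relation $\sim$ such that for all $P,Q,R\in\mathcal P$: 1. if $P\sim Q$, then $PR\sim QR$; 2. $(PQ)R\sim P(QR)$, $PQ\sim QP$, and $IP\sim PI\sim P$ for every one-element interval $I\in\mathcal P$; 3. if $P\sim Q$, there is a bijection $x\mapsto x'$ from $P$ to $Q$ with $[\hat 0,x]\sim[\hat 0,x']$ and $[x,\hat 1]\sim[x',\hat 1]$ for all $x\in P$; 4. there is a poset isomorphism $\psi:P\times Q\to PQ$ with $[\hat 0,\psi(x,y)]\sim[\hat 0,x][\hat 0,y]$ and $[\psi(x,y),\hat 1]\sim[x,\hat 1][y,\hat 1]$ for all $(x,y)\in P\times Q$; moreover, if $P,Q$ each have more than one element and $R\sim PQ$, there is such an isomorphism $\psi:P\times Q\to R$ as well. Let $k$ be a commutative ring and let $H(\mathcal P)$ be the incidence Hopf algebra of $\mathcal P$: the monoid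 algebra over $k$ of $\mathcal P/\!\sim$, with $\delta(P)=\sum_{x\in P}[\hat 0,x]\otimes[x,\hat 1]$, and with $\epsilon(P)=1$ if $|P|=1$ and $\epsilon(P)=0$ otherwise. Let $\chi$ be its antipode (intervals denote their classes). For $P\in\mathcal P$, let $I(P)$ be the set of all $x\in P\setminus\{\hat 0,\hat 1\}$ such that $[\hat 0,x]$ is not equivalent to a product of two members of $\mathcal P$ with more than one element each. Let $Z(P)$ be the set of all $a\in P$ for which there is $a'\in P$ with $[\hat 0,a]\cap[\hat 0,a']=\{\hat 0\}$ and $[\hat 0,a][\hat 0,a']\sim P$, and let $Z'(P)$ be the set of minimal elements of $Z(P)\setminus\{\hat 0\}$. A *forest* of $P$ is a pair $(F,J_F)$ with $F\subseteq I(P)$ and $J_F:2^F\to P\setminus\{\hat 1\}$ such that $J_F(\{a\})=a$ for all $a\in F$ and 1. for $a_1,a_2\in F$, either $a_1\le a_2$, or $a_2\le a_1$, or $[\hat 0,a_1]\cap[\hat 0,a_2]=\{\hat 0\}$; 2. if $G\subseteq F$ and $\{a_i\}$ is the set of maximal elements of $G$, then $[\hat 0,J_F(G)]\sim\prod_i[\hat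 0,a_i]$; 3. if $G'\subseteq G\subseteq F$, then $J_F(G')\le J_F(G)$. Let $\mathcal F(P)$ be the set of all forests of $P$, and let $d(F)=|F|+1$. For $(F,J_F)\in\mathcal F(P)$ and $a\in F\cup Z'(P)$, let $\tilde a=J_F(\{b\in F: b<a,\text{ and there is no } c\in F \text{ with } b<c<a\})$. **Theorem.** Let $\mathcal P$ be a hereditary family of posets and let $P\in\mathcal P$ have more than one element. Then $\tilde a\le a$ for every $(F,J_F)\in\mathcal F(P)$ and every $a\in F\cup Z'(P)$, and with $\Theta(F,J_F)=\prod_{a\in F\cup Z'(P)}[\tilde a,a]$, $$\chi(P)=\sum_{(F,J_F)\in\mathcal F(P)}(-1)^{d(F)}\,\Theta(F,J_F)\quad\text{in } H(\mathcal P).$$ -/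

import Mathlib

open scoped TensorProduct BigOperators

universe u v

/-- A finite interval: a finite partially ordered set, whose underlying set is a finite set of
elements of `α`, with a least element `bot` and a greatest element `top`. -/
@[ext]
structure FinInterval (α : Type u) where
  carrier : Finset α
  le : α → α → Prop
  bot : α
  top : α
  mem_of_le : ∀ x y, le x y → x ∈ carrier ∧ y ∈ carrier
  le_refl : ∀ x ∈ carrier, le x x
  le_antisymm : ∀ x y, le x y → le y x → x = y
  le_trans : ∀ x y z, le x y → le y z → le x z
  bot_mem : bot ∈ carrier
  top_mem : top ∈ carrier
  bot_le : ∀ x ∈ carrier, le bot x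
  le_top : ∀ x ∈ carrier, le x top

namespace FinInterval

variable {α : Type u}

/-- The type of elements of a finite interval. -/
@[ext]
structure Elem (P : FinInterval α) : Type u where
  val : α
  mem : val ∈ P.carrier

instance (P : FinInterval α) : Fintype P.Elem :=
  Fintype.ofEquiv {x : α // x ∈ P.carrier}
    ⟨fun x => ⟨x.1, x.2⟩, fun x => ⟨x.1, x.2⟩, fun _ => rfl, fun _ => rfl⟩

noncomputable instance (P : FinInterval α) : DecidableEq P.Elem := Classical.decEq _

instance (P : FinInterval α) : PartialOrder P.Elem where
  le x y := P.le x.1 y.1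
  le_refl x := P.le_refl _ x.2
  le_trans _ _ _ := P.le_trans _ _ _
  le_antisymm _ _ h h' := Elem.ext (P.le_antisymm _ _ h h')

instance (P : FinInterval α) : BoundedOrder P.Elem where
  bot := ⟨P.bot, P.bot_mem⟩
  bot_le x := P.bot_le _ x.2
  top := ⟨P.top, P.top_mem⟩
  le_top x := P.le_top _ x.2

open Classical in
/-- The subinterval `[x, y]` of `P`, for `x ≤ y`, with the order of `P`. -/
noncomputable def sub (P : FinInterval α) {x y : P.Elem} (h : x ≤ y) : FinInterval α where
  carrier := P.carrier.filter fun z => P.le x.1 z ∧ P.le z y.1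
  le a b := P.le x.1 a ∧ P.le a b ∧ P.le b y.1
  bot := x.1
  top := y.1
  mem_of_le a b := by
    rintro ⟨h1, h2, h3⟩
    simp only [Finset.mem_filter]
    exact ⟨⟨(P.mem_of_le _ _ h1).2, h1, P.le_trans _ _ _ h2 h3⟩,
      ⟨(P.mem_of_le _ _ h3).1, P.le_trans _ _ _ h1 h2, h3⟩⟩
  le_refl a ha := by
    simp only [Finset.mem_filter] at ha
    exact ⟨ha.2.1, P.le_refl _ ha.1, ha.2.2⟩
  le_antisymm _ _ h1 h2 := P.le_antisymm _ _ h1.2.1 h2.2.1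
  le_trans _ _ _ h1 h2 := ⟨h1.1, P.le_trans _ _ _ h1.2.1 h2.2.1, h2.2.2⟩
  bot_mem := by
    simp only [Finset.mem_filter]
    exact ⟨x.2, P.le_refl _ x.2, h⟩
  top_mem := by
    simp only [Finset.mem_filter]
    exact ⟨y.2, h, P.le_refl _ y.2⟩
  bot_le a ha := by
    simp only [Finset.mem_filter] at ha
    exact ⟨P.le_refl _ x.2, ha.2⟩
  le_top a ha := by
    simp only [Finset.mem_filter] at ha
    exact ⟨ha.2.1, ha.2.2, P.le_refl _ y.2⟩

theorem mem_sub {P : FinInterval α} {x y : P.Elem} {h : x ≤ y} {z : α} :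
    z ∈ (P.sub h).carrier ↔ P.le x.1 z ∧ P.le z y.1 := by
  classical
  simp only [sub, Finset.mem_filter]
  exact ⟨fun h => h.2, fun h => ⟨(P.mem_of_le _ _ h.1).2, h⟩⟩

/-- The elements of `[x, y]` are the elements of `P` between `x` and `y`. -/
def subEquiv (P : FinInterval α) {x y : P.Elem} (h : x ≤ y) :
    (P.sub h).Elem ≃ {z : P.Elem // x ≤ z ∧ z ≤ y} where
  toFun z := ⟨⟨z.1, (P.mem_of_le _ _ (mem_sub.1 z.2).1).2⟩, mem_sub.1 z.2⟩
  invFun z := ⟨z.1.1, mem_sub.2 z.2⟩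
  left_inv _ := rfl
  right_inv _ := rfl

/-- An interval is a subinterval of itself. -/
theorem sub_bot_top (P : FinInterval α) (h : (⊥ : P.Elem) ≤ ⊤) : P.sub h = P := by
  have key : ∀ z, (P.le P.bot z ∧ P.le z P.top) ↔ z ∈ P.carrier := fun z =>
    ⟨fun h => (P.mem_of_le _ _ h.1).2, fun h => ⟨P.bot_le _ h, P.le_top _ h⟩⟩
  refine FinInterval.ext ?_ ?_ rfl rfl
  · ext z
    rw [mem_sub]
    exact key z
  · ext a b
    refine ⟨fun h => h.2.1, fun h => ?_⟩
    obtain ⟨ha, hb⟩ := P.mem_of_le _ _ h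
    exact ⟨P.bot_le _ ha, h, P.le_top _ hb⟩

/-- A subinterval of a subinterval is a subinterval. -/
theorem sub_sub (P : FinInterval α) {x y : P.Elem} (h : x ≤ y) {a b : (P.sub h).Elem}
    (hab : a ≤ b) (hab' : (P.subEquiv h a).1 ≤ (P.subEquiv h b).1) :
    (P.sub h).sub hab = P.sub hab' := by
  have ha := mem_sub.1 a.2
  have hb := mem_sub.1 b.2
  refine FinInterval.ext ?_ ?_ rfl rfl
  · ext z
    refine mem_sub.trans <| Iff.trans ?_ mem_sub.symm
    refine ⟨fun h => ⟨h.1.2.1, h.2.2.1⟩, fun h => ⟨⟨ha.1, h.1, P.le_trans _ _ _ h.2 hb.2⟩,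
      P.le_trans _ _ _ ha.1 h.1, h.2, hb.2⟩⟩
  · ext c d
    constructor
    · rintro ⟨h1, h2, h3⟩
      exact ⟨h1.2.1, h2.2.1, h3.2.1⟩
    · rintro ⟨h1, h2, h3⟩
      have h1 : P.le a.1 c := h1
      have h3 : P.le d b.1 := h3
      have h4 := P.le_trans _ _ _ ha.1 h1
      have h5 := P.le_trans _ _ _ h3 hb.2
      exact ⟨⟨ha.1, h1, P.le_trans _ _ _ h2 h5⟩, ⟨h4, h2, h5⟩,
        ⟨P.le_trans _ _ _ h4 h2, h3, hb.2⟩⟩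

end FinInterval

/-- A nonempty family of finite intervals that is closed under the formation of subintervals. -/
structure IntervalFamily (α : Type u) where
  members : Set (FinInterval α)
  members_nonempty : members.Nonempty
  sub_mem : ∀ P ∈ members, ∀ (x y : P.Elem) (h : x ≤ y), P.sub h ∈ members

namespace IntervalFamily

variable {α : Type u}

/-- The members of a family of intervals. -/
structure Obj (𝓕 : IntervalFamily α) : Type u where
  val : FinInterval α
  mem : val ∈ 𝓕.members

variable {𝓕 : IntervalFamily α}

/-- The elements of a member of a family. -/
abbrev Obj.Elem (P : 𝓕.Obj) : Type u := P.1.Elem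

/-- The subinterval `[x, y]` as a member of the family. -/
noncomputable def Obj.itv (P : 𝓕.Obj) {x y : P.Elem} (h : x ≤ y) : 𝓕.Obj :=
  ⟨P.1.sub h, 𝓕.sub_mem P.1 P.2 x y h⟩

/-- The lower interval `[0, x]`. -/
noncomputable abbrev Obj.lower (P : 𝓕.Obj) (x : P.Elem) : 𝓕.Obj := P.itv (bot_le : ⊥ ≤ x)

/-- The upper interval `[x, 1]`. -/
noncomputable abbrev Obj.upper (P : 𝓕.Obj) (x : P.Elem) : 𝓕.Obj := P.itv (le_top : x ≤ ⊤)

/-- The interval has exactly one element. -/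
abbrev Obj.IsPoint (P : 𝓕.Obj) : Prop := (⊥ : P.Elem) = ⊤

end IntervalFamily

/-- A hereditary family of posets: a family of finite intervals, closed under the formation of
subintervals, with an equivalence relation `rel` and a product `mul`. -/
structure HereditaryFamily (α : Type u) extends IntervalFamily α where
  rel : toIntervalFamily.Obj → toIntervalFamily.Obj → Prop
  rel_equiv : Equivalence rel
  mul : toIntervalFamily.Obj → toIntervalFamily.Obj → toIntervalFamily.Obj
  mul_congr : ∀ P Q R, rel P Q → rel (mul P R) (mul Q R)
  mul_assoc : ∀ P Q R, rel (mul (mul P Q) R) (mul P (mul Q R))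
  point_mul : ∀ I P, I.IsPoint → rel (mul I P) P
  mul_point : ∀ I P, I.IsPoint → rel (mul P I) P
  mul_comm : ∀ P Q, rel (mul P Q) (mul Q P)
  /-- Equivalent intervals have, up to equivalence, the same lower and upper intervals. -/
  exists_bij : ∀ P Q, rel P Q → ∃ e : P.Elem ≃ Q.Elem, ∀ x,
    rel (P.lower x) (Q.lower (e x)) ∧ rel (P.upper x) (Q.upper (e x))
  /-- The product is the Cartesian product, compatibly with lower and upper intervals. -/
  exists_prod : ∀ P Q, ∃ ψ : P.Elem × Q.Elem ≃o (mul P Q).Elem, ∀ x y,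
    rel ((mul P Q).lower (ψ (x, y))) (mul (P.lower x) (Q.lower y)) ∧
      rel ((mul P Q).upper (ψ (x, y))) (mul (P.upper x) (Q.upper y))
  /-- The same for every interval that is equivalent to a product of non-singleton intervals, so
  that a decomposition up to `rel` is realized by a Cartesian decomposition. -/
  exists_prod_of_rel : ∀ P Q R, ¬ P.IsPoint → ¬ Q.IsPoint → rel R (mul P Q) →
    ∃ ψ : P.Elem × Q.Elem ≃o R.Elem, ∀ x y,
      rel (R.lower (ψ (x, y))) (mul (P.lower x) (Q.lower y)) ∧
        rel (R.upper (ψ (x, y))) (mul (P.upper x) (Q.upper y))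

namespace HereditaryFamily

variable {α : Type u}

/-- The members of a hereditary family. -/
abbrev Obj (𝓕 : HereditaryFamily α) : Type u := 𝓕.toIntervalFamily.Obj

/-- The set `𝓕 / ∼` of equivalence classes. -/
def Types (𝓕 : HereditaryFamily α) : Type u := Quotient (⟨𝓕.rel, 𝓕.rel_equiv⟩ : Setoid 𝓕.Obj)

variable {𝓕 : HereditaryFamily α}

/-- The equivalence class of a member of the family. -/
def type (P : 𝓕.Obj) : 𝓕.Types := Quotient.mk _ P

theorem type_eq_iff {P Q : 𝓕.Obj} : type P = type Q ↔ 𝓕.rel P Q :=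
  Quotient.eq (r := ⟨𝓕.rel, 𝓕.rel_equiv⟩)

theorem type_surjective : Function.Surjective (type : 𝓕.Obj → 𝓕.Types) := Quotient.mk_surjective

theorem mul_congr₂ {P P' Q Q' : 𝓕.Obj} (h : 𝓕.rel P P') (h' : 𝓕.rel Q Q') :
    𝓕.rel (𝓕.mul P Q) (𝓕.mul P' Q') :=
  𝓕.rel_equiv.trans (𝓕.mul_congr _ _ _ h) <| 𝓕.rel_equiv.trans (𝓕.mul_comm _ _) <|
    𝓕.rel_equiv.trans (𝓕.mul_congr _ _ _ h') (𝓕.mul_comm _ _)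

theorem isPoint_lower_bot (P : 𝓕.Obj) : (P.lower ⊥).IsPoint := rfl

theorem isPoint_upper_top (P : 𝓕.Obj) : (P.upper ⊤).IsPoint := rfl

/-- A one-element member of the family. -/
noncomputable def point (𝓕 : HereditaryFamily α) : 𝓕.Obj :=
  IntervalFamily.Obj.lower (𝓕 := 𝓕.toIntervalFamily)
    ⟨𝓕.members_nonempty.some, 𝓕.members_nonempty.some_mem⟩ ⊥

theorem isPoint_point (𝓕 : HereditaryFamily α) : 𝓕.point.IsPoint := rfl

/-- The product of the family makes `𝓕 / ∼` a commutative monoid, with the class of the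
one-element intervals as its unit. -/
noncomputable instance : CommMonoid 𝓕.Types where
  mul := Quotient.map₂ 𝓕.mul fun _ _ h _ _ h' => mul_congr₂ h h'
  one := type 𝓕.point
  mul_assoc := by
    rintro ⟨P⟩ ⟨Q⟩ ⟨R⟩
    exact type_eq_iff.2 (𝓕.mul_assoc P Q R)
  one_mul := by
    rintro ⟨P⟩
    exact type_eq_iff.2 (𝓕.point_mul _ P 𝓕.isPoint_point)
  mul_one := by
    rintro ⟨P⟩
    exact type_eq_iff.2 (𝓕.mul_point _ P 𝓕.isPoint_point)
  mul_comm := by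
    rintro ⟨P⟩ ⟨Q⟩
    exact type_eq_iff.2 (𝓕.mul_comm P Q)

theorem type_mul (P Q : 𝓕.Obj) : type (𝓕.mul P Q) = type P * type Q := rfl

theorem card_eq_of_rel {P Q : 𝓕.Obj} (h : 𝓕.rel P Q) :
    Fintype.card P.Elem = Fintype.card Q.Elem := by
  obtain ⟨e, -⟩ := 𝓕.exists_bij _ _ h
  exact Fintype.card_congr e

theorem isPoint_iff_card {P : 𝓕.Obj} : P.IsPoint ↔ Fintype.card P.Elem = 1 := by
  rw [Fintype.card_eq_one_iff]
  constructor
  · intro h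
    exact ⟨⊥, fun y => le_antisymm (h ▸ le_top) bot_le⟩
  · rintro ⟨x, hx⟩
    exact (hx _).trans (hx _).symm

theorem isPoint_of_rel {P Q : 𝓕.Obj} (h : 𝓕.rel P Q) (hP : P.IsPoint) : Q.IsPoint := by
  rw [isPoint_iff_card] at *
  rw [← card_eq_of_rel h, hP]

theorem type_eq_one_iff {P : 𝓕.Obj} : type P = 1 ↔ P.IsPoint := by
  constructor
  · intro h
    exact isPoint_of_rel (𝓕.rel_equiv.symm (type_eq_iff.1 h)) 𝓕.isPoint_point
  · intro h
    have h1 := 𝓕.point_mul P 𝓕.point h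
    have h2 := 𝓕.mul_point 𝓕.point P 𝓕.isPoint_point
    have h3 : type P * 1 = type P := mul_one _
    have h4 : type P * 1 = 1 := type_eq_iff.2 h1
    rw [← h3, h4]

theorem isPoint_mul_iff {P Q : 𝓕.Obj} : (𝓕.mul P Q).IsPoint ↔ P.IsPoint ∧ Q.IsPoint := by
  obtain ⟨ψ, -⟩ := 𝓕.exists_prod P Q
  have := Fintype.card_congr ψ.toEquiv
  rw [Fintype.card_prod] at this
  simp only [isPoint_iff_card]
  rw [← this]
  exact ⟨fun h => ⟨Nat.eq_one_of_mul_eq_one_right h, Nat.eq_one_of_mul_eq_one_left h⟩, fun h => by rw [h.1, h.2]⟩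

open Classical in
/-- The class of the interval `[x, y]` of `P`; the value is `1` if `x ≤ y` does not hold. -/
noncomputable def itvType (P : 𝓕.Obj) (x y : P.Elem) : 𝓕.Types :=
  if h : x ≤ y then type (P.itv h) else 1

theorem itvType_of_le (P : 𝓕.Obj) {x y : P.Elem} (h : x ≤ y) :
    itvType P x y = type (P.itv h) := dif_pos h

/-- The inclusion of the elements of `[x, y]` into the elements of `P`. -/
def incl (P : 𝓕.Obj) {x y : P.Elem} (h : x ≤ y) (z : (P.itv h).Elem) : P.Elem :=
  (P.val.subEquiv h z).1

theorem incl_le_incl (P : 𝓕.Obj) {x y : P.Elem} (h : x ≤ y) {a b : (P.itv h).Elem} :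
    incl P h a ≤ incl P h b ↔ a ≤ b :=
  ⟨fun hab => ⟨(P.val.subEquiv h a).2.1, hab, (P.val.subEquiv h b).2.2⟩, fun hab => hab.2.1⟩

theorem itv_itv (P : 𝓕.Obj) {x y : P.Elem} (h : x ≤ y) {a b : (P.itv h).Elem} (hab : a ≤ b) :
    (P.itv h).itv hab = P.itv ((incl_le_incl P h).2 hab) := by
  unfold IntervalFamily.Obj.itv
  congr 1
  exact P.val.sub_sub h hab _

theorem itvType_itv (P : 𝓕.Obj) {x y : P.Elem} (h : x ≤ y) (a b : (P.itv h).Elem) :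
    itvType (P.itv h) a b = itvType P (incl P h a) (incl P h b) := by
  by_cases hab : a ≤ b
  · rw [itvType_of_le _ hab, itvType_of_le _ ((incl_le_incl P h).2 hab), itv_itv]
  · unfold itvType
    rw [dif_neg hab, dif_neg (fun h' => hab ((incl_le_incl P h).1 h'))]

theorem itvType_bot_top (P : 𝓕.Obj) : itvType P ⊥ ⊤ = type P := by
  rw [itvType_of_le _ bot_le]
  congr 1
  unfold IntervalFamily.Obj.itv
  obtain ⟨P, hP⟩ := P
  congr 1
  exact P.sub_bot_top _

theorem itvType_self (P : 𝓕.Obj) (x : P.Elem) : itvType P x x = 1 := by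
  rw [itvType_of_le _ le_rfl, type_eq_one_iff]
  rfl

theorem itvType_eq_one_iff (P : 𝓕.Obj) {x y : P.Elem} (h : x ≤ y) :
    itvType P x y = 1 ↔ x = y := by
  rw [itvType_of_le _ h, type_eq_one_iff]
  constructor
  · intro h'
    exact congrArg (incl P h) h'
  · rintro rfl
    rfl

open Classical in
theorem sum_itv {A : Type*} [AddCommMonoid A] (P : 𝓕.Obj) {x y : P.Elem} (h : x ≤ y)
    (g : P.Elem → A) :
    ∑ z : (P.itv h).Elem, g (incl P h z) = ∑ z with x ≤ z ∧ z ≤ y, g z := by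
  rw [← Finset.sum_subtype_eq_sum_filter, Finset.subtype_univ]
  exact Fintype.sum_equiv (P.val.subEquiv h) _ _ fun _ => rfl

theorem incl_bot (P : 𝓕.Obj) {x y : P.Elem} (h : x ≤ y) : incl P h ⊥ = x := rfl

theorem incl_top (P : 𝓕.Obj) {x y : P.Elem} (h : x ≤ y) : incl P h ⊤ = y := rfl

/-- Equivalent intervals have the same lower and upper intervals, in terms of classes. -/
theorem exists_bij_type {P Q : 𝓕.Obj} (h : type P = type Q) : ∃ e : P.Elem ≃ Q.Elem, ∀ x,
    itvType P ⊥ x = itvType Q ⊥ (e x) ∧ itvType P x ⊤ = itvType Q (e x) ⊤ := by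
  obtain ⟨e, he⟩ := 𝓕.exists_bij _ _ (type_eq_iff.1 h)
  refine ⟨e, fun x => ?_⟩
  simp only [itvType_of_le _ bot_le, itvType_of_le _ le_top, type_eq_iff]
  exact he x

theorem exists_prod_type (P Q : 𝓕.Obj) : ∃ e : P.Elem × Q.Elem ≃ (𝓕.mul P Q).Elem, ∀ x y,
    itvType (𝓕.mul P Q) ⊥ (e (x, y)) = itvType P ⊥ x * itvType Q ⊥ y ∧
      itvType (𝓕.mul P Q) (e (x, y)) ⊤ = itvType P x ⊤ * itvType Q y ⊤ := by
  obtain ⟨e, he⟩ := 𝓕.exists_prod P Q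
  refine ⟨e.toEquiv, fun x y => ?_⟩
  simp only [itvType_of_le _ bot_le, itvType_of_le _ le_top, ← type_mul, type_eq_iff]
  exact he x y

end HereditaryFamily

/-- The underlying algebra of the incidence Hopf algebra: the monoid algebra of `𝓕 / ∼`. -/
def IncidenceHopf (k : Type v) [CommRing k] {α : Type u} (𝓕 : HereditaryFamily α) : Type (max u v) :=
  MonoidAlgebra k 𝓕.Types

namespace IncidenceHopf

open HereditaryFamily

variable (k : Type v) [CommRing k] {α : Type u} {𝓕 : HereditaryFamily α}

noncomputable instance : CommRing (IncidenceHopf k 𝓕) :=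
  inferInstanceAs (CommRing (MonoidAlgebra k 𝓕.Types))

noncomputable instance : Algebra k (IncidenceHopf k 𝓕) :=
  inferInstanceAs (Algebra k (MonoidAlgebra k 𝓕.Types))

/-- A class of intervals, as an element of the incidence Hopf algebra. -/
noncomputable def of : 𝓕.Types →* IncidenceHopf k 𝓕 := MonoidAlgebra.of k 𝓕.Types

variable {k}

/-- An algebra homomorphism is given by its values on the classes. -/
noncomputable def lift {A : Type*} [Semiring A] [Algebra k A] (f : 𝓕.Types →* A) :
    IncidenceHopf k 𝓕 →ₐ[k] A :=
  MonoidAlgebra.lift k A 𝓕.Types f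

theorem lift_of {A : Type*} [Semiring A] [Algebra k A] (f : 𝓕.Types →* A) (m : 𝓕.Types) :
    lift (k := k) f (of k m) = f m := MonoidAlgebra.lift_of f m

theorem algHom_ext {A : Type*} [Semiring A] [Algebra k A] {f g : IncidenceHopf k 𝓕 →ₐ[k] A}
    (h : ∀ P : 𝓕.Obj, f (of k (type P)) = g (of k (type P))) : f = g := by
  have h : ∀ m, f (of k m) = g (of k m) := fun m => by
    obtain ⟨P, rfl⟩ := type_surjective m
    exact h P
  exact MonoidAlgebra.algHom_ext (M := 𝓕.Types) (R := k) (A := k) h (by ext)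

/-- A linear map is given by its values on the classes. -/
noncomputable def linearLift {A : Type*} [AddCommMonoid A] [Module k A] (f : 𝓕.Types → A) :
    IncidenceHopf k 𝓕 →ₗ[k] A :=
  Finsupp.linearCombination k f ∘ₗ (MonoidAlgebra.coeffLinearEquiv k).toLinearMap

theorem linearLift_of {A : Type*} [AddCommMonoid A] [Module k A] (f : 𝓕.Types → A)
    (m : 𝓕.Types) : linearLift (k := k) f (of k m) = f m := by
  have : linearLift (k := k) f (of k m) = Finsupp.linearCombination k f (Finsupp.single m 1) := rfl
  rw [this]
  simp

theorem linearMap_ext {A : Type*} [AddCommMonoid A] [Module k A] {f g : IncidenceHopf k 𝓕 →ₗ[k] A}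
    (h : ∀ P : 𝓕.Obj, f (of k (type P)) = g (of k (type P))) : f = g := by
  have h : ∀ m, f (of k m) = g (of k m) := fun m => by
    obtain ⟨P, rfl⟩ := type_surjective m
    exact h P
  apply LinearMap.ext
  intro x
  induction x using MonoidAlgebra.induction_linear with
  | zero => exact f.map_zero.trans g.map_zero.symm
  | add x y hx hy =>
    exact (f.map_add x y).trans ((congrArg₂ _ hx hy).trans (g.map_add x y).symm)
  | single m a =>
    have : (MonoidAlgebra.single m a : MonoidAlgebra k 𝓕.Types) = a • MonoidAlgebra.of k 𝓕.Types m := by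
      simp
    rw [this]
    exact (f.map_smul a _).trans ((congrArg _ (h m)).trans (g.map_smul a _).symm)

theorem sum_congr_type {A : Type*} [AddCommMonoid A] (f : 𝓕.Types → 𝓕.Types → A) {P Q : 𝓕.Obj}
    (h : type P = type Q) :
    ∑ x : P.Elem, f (itvType P ⊥ x) (itvType P x ⊤) =
      ∑ x : Q.Elem, f (itvType Q ⊥ x) (itvType Q x ⊤) := by
  obtain ⟨e, he⟩ := exists_bij_type h
  exact Fintype.sum_equiv e _ _ fun x => by rw [(he x).1, (he x).2]

/-- `∑ f([0, x], [x, 1])` over the elements `x` of an interval, as a function of its class. -/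
noncomputable def sumType {A : Type*} [AddCommMonoid A] (f : 𝓕.Types → 𝓕.Types → A) :
    𝓕.Types → A :=
  Quotient.lift (fun P => ∑ x : IntervalFamily.Obj.Elem P, f (itvType P ⊥ x) (itvType P x ⊤))
    fun _ _ h => sum_congr_type f (type_eq_iff.2 h)

theorem sumType_type {A : Type*} [AddCommMonoid A] (f : 𝓕.Types → 𝓕.Types → A) (P : 𝓕.Obj) :
    sumType f (type P) = ∑ x : P.Elem, f (itvType P ⊥ x) (itvType P x ⊤) := rfl

variable (k) in
/-- The comultiplication `δ(P) = ∑ x, [0, x] ⊗ [x, 1]`, as an algebra homomorphism. -/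
noncomputable def comulHom :
    IncidenceHopf k 𝓕 →ₐ[k] IncidenceHopf k 𝓕 ⊗[k] IncidenceHopf k 𝓕 :=
  lift
    { toFun := sumType fun a b => of k a ⊗ₜ[k] of k b
      map_one' := by
        have h : (⊥ : 𝓕.point.Elem) = ⊤ := 𝓕.isPoint_point
        have : Unique 𝓕.point.Elem := ⟨⟨⊥⟩, fun x => le_antisymm (h ▸ le_top) bot_le⟩
        have h1 : (1 : 𝓕.Types) = type 𝓕.point := rfl
        rw [h1, sumType_type, Fintype.sum_unique, Subsingleton.elim default ⊥,
          ← Subsingleton.elim ⊥ (⊤ : 𝓕.point.Elem), itvType_self, map_one,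
          Algebra.TensorProduct.one_def]
      map_mul' := by
        intro m n
        obtain ⟨P, rfl⟩ := type_surjective m
        obtain ⟨Q, rfl⟩ := type_surjective n
        obtain ⟨e, he⟩ := exists_prod_type P Q
        rw [← type_mul, sumType_type, sumType_type, sumType_type, Fintype.sum_mul_sum,
          ← Fintype.sum_prod_type', ← e.sum_comp]
        refine Finset.sum_congr rfl fun x _ => ?_
        rw [(he x.1 x.2).1, (he x.1 x.2).2, map_mul, map_mul,
          Algebra.TensorProduct.tmul_mul_tmul] }

theorem comulHom_of (P : 𝓕.Obj) : comulHom k (of k (type P)) =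
    ∑ x : P.Elem, of k (itvType P ⊥ x) ⊗ₜ[k] of k (itvType P x ⊤) := lift_of _ _

open Classical in
variable (k) in
/-- The counit: `ε(P) = 1` if `P` has one element, and `ε(P) = 0` otherwise. -/
noncomputable def counitHom : IncidenceHopf k 𝓕 →ₐ[k] k :=
  lift
    { toFun := fun m => if m = 1 then 1 else 0
      map_one' := if_pos rfl
      map_mul' := by
        intro m n
        obtain ⟨P, rfl⟩ := type_surjective m
        obtain ⟨Q, rfl⟩ := type_surjective n
        simp only [← type_mul, type_eq_one_iff, isPoint_mul_iff]
        by_cases hP : P.IsPoint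
        · by_cases hQ : Q.IsPoint
          · rw [if_pos hP, if_pos hQ, if_pos ⟨hP, hQ⟩, one_mul]
          · rw [if_neg hQ, if_neg (fun h => hQ h.2), mul_zero]
        · rw [if_neg hP, if_neg (fun h => hP h.1), zero_mul] }

open Classical in
theorem counitHom_of (m : 𝓕.Types) : counitHom k (of k m) = if m = 1 then 1 else 0 :=
  lift_of _ _

open Classical in
theorem comulHom_itvType (P : 𝓕.Obj) {x y : P.Elem} (h : x ≤ y) :
    comulHom k (of k (itvType P x y)) =
      ∑ z : P.Elem with x ≤ z ∧ z ≤ y, of k (itvType P x z) ⊗ₜ[k] of k (itvType P z y) := by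
  rw [itvType_of_le _ h, comulHom_of,
    ← sum_itv P h fun z => of k (itvType P x z) ⊗ₜ[k] of k (itvType P z y)]
  exact Finset.sum_congr rfl fun z _ => by
    rw [itvType_itv, itvType_itv, incl_bot, incl_top]

/-- The incidence Hopf algebra as a bialgebra. -/
noncomputable instance : Bialgebra k (IncidenceHopf k 𝓕) :=
  Bialgebra.ofAlgHom (comulHom k) (counitHom k)
    (by
      classical
      refine algHom_ext fun P => ?_
      simp only [AlgHom.comp_apply, comulHom_of, map_sum, Algebra.TensorProduct.map_tmul,
        AlgHom.id_apply, comulHom_itvType P bot_le, comulHom_itvType P le_top,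
        TensorProduct.sum_tmul, TensorProduct.tmul_sum, bot_le, le_top, true_and, and_true]
      rw [Finset.sum_comm' (t' := Finset.univ) (s' := fun z => Finset.univ.filter fun x => z ≤ x)]
      · rfl
      · simp)
    (by
      classical
      refine algHom_ext fun P => ?_
      simp only [AlgHom.comp_apply, comulHom_of, map_sum, Algebra.TensorProduct.map_tmul,
        AlgHom.id_apply, counitHom_of, itvType_eq_one_iff P bot_le]
      rw [Finset.sum_eq_single ⊥]
      · simp only [if_true, itvType_bot_top]
        rfl
      · intro x _ hx
        rw [if_neg hx.symm, TensorProduct.zero_tmul]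
      · simp)
    (by
      classical
      refine algHom_ext fun P => ?_
      simp only [AlgHom.comp_apply, comulHom_of, map_sum, Algebra.TensorProduct.map_tmul,
        AlgHom.id_apply, counitHom_of, itvType_eq_one_iff P le_top]
      rw [Finset.sum_eq_single ⊤]
      · simp only [if_true, itvType_bot_top]
        rfl
      · intro x _ hx
        rw [if_neg hx, TensorProduct.tmul_zero]
      · simp)

theorem comul_of (P : 𝓕.Obj) : Coalgebra.comul (R := k) (of k (type P)) =
    ∑ x : P.Elem, of k (itvType P ⊥ x) ⊗ₜ[k] of k (itvType P x ⊤) := comulHom_of P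

open Classical in
theorem counit_of (m : 𝓕.Types) :
    Coalgebra.counit (R := k) (of k m) = if m = 1 then 1 else 0 := counitHom_of m

theorem card_lower_lt {P : 𝓕.Obj} {x : P.Elem} (hx : x ≠ ⊤) :
    Fintype.card (P.lower x).Elem < Fintype.card P.Elem := by
  refine Fintype.card_lt_of_injective_of_notMem (incl P bot_le) (b := ⊤) ?_ ?_
  · intro a b h
    exact (P.val.subEquiv _).injective (Subtype.ext h)
  · rintro ⟨z, hz⟩
    exact hx (top_le_iff.1 (hz ▸ (P.val.subEquiv bot_le z).2.2))

theorem card_upper_lt {P : 𝓕.Obj} {x : P.Elem} (hx : x ≠ ⊥) :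
    Fintype.card (P.upper x).Elem < Fintype.card P.Elem := by
  refine Fintype.card_lt_of_injective_of_notMem (incl P le_top) (b := ⊥) ?_ ?_
  · intro a b h
    exact (P.val.subEquiv _).injective (Subtype.ext h)
  · rintro ⟨z, hz⟩
    exact hx (le_bot_iff.1 (hz ▸ (P.val.subEquiv le_top z).2.1))

/-- The number of elements of the intervals of a class. -/
def typeCard : 𝓕.Types → ℕ :=
  Quotient.lift (fun P => Fintype.card (IntervalFamily.Obj.Elem P)) fun _ _ h => card_eq_of_rel h

open Classical in
/-- The left convolution inverse of the identity, by recursion on the number of elements. -/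
noncomputable def leftInv (m : 𝓕.Types) : IncidenceHopf k 𝓕 :=
  if m = 1 then 1 else
    - sumType (fun a b => if typeCard a < typeCard m then leftInv a * of k b else 0) m
termination_by typeCard m
decreasing_by assumption

open Classical in
/-- The right convolution inverse of the identity, by recursion on the number of elements. -/
noncomputable def rightInv (m : 𝓕.Types) : IncidenceHopf k 𝓕 :=
  if m = 1 then 1 else
    - sumType (fun a b => if typeCard b < typeCard m then of k a * rightInv b else 0) m
termination_by typeCard m
decreasing_by assumption

theorem sum_leftInv (P : 𝓕.Obj) :
    ∑ x : P.Elem, leftInv (k := k) (itvType P ⊥ x) * of k (itvType P x ⊤) =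
      algebraMap k _ (counitHom k (of k (type P))) := by
  classical
  rw [counitHom_of]
  by_cases hP : type P = 1
  · have h : (⊥ : P.Elem) = ⊤ := type_eq_one_iff.1 hP
    have : Unique P.Elem := ⟨⟨⊥⟩, fun x => le_antisymm (h ▸ le_top) bot_le⟩
    rw [if_pos hP, map_one, Fintype.sum_unique, Subsingleton.elim default (⊥ : P.Elem), ← h,
      itvType_self, leftInv, if_pos rfl, map_one, one_mul]
  · have key : leftInv (k := k) (type P) = - ∑ x : P.Elem, (if typeCard (itvType P ⊥ x) < typeCard (type P) then leftInv (k := k) (itvType P ⊥ x) * of k (itvType P x ⊤) else 0) := by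
      rw [leftInv, if_neg hP, sumType_type]
    rw [if_neg hP, map_zero, ← Finset.sum_erase_add _ _ (Finset.mem_univ (⊤ : P.Elem)),
      itvType_bot_top, itvType_self, map_one, mul_one, key,
      ← Finset.sum_erase_add _ _ (Finset.mem_univ (⊤ : P.Elem)), itvType_bot_top,
      if_neg (lt_irrefl _), add_zero, ← sub_eq_add_neg, sub_eq_zero]
    refine Finset.sum_congr rfl fun x hx => ?_
    rw [if_pos]
    rw [itvType_of_le _ bot_le]
    exact card_lower_lt (Finset.ne_of_mem_erase hx)

theorem sum_rightInv (P : 𝓕.Obj) :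
    ∑ x : P.Elem, of k (itvType P ⊥ x) * rightInv (k := k) (itvType P x ⊤) =
      algebraMap k _ (counitHom k (of k (type P))) := by
  classical
  rw [counitHom_of]
  by_cases hP : type P = 1
  · have h : (⊥ : P.Elem) = ⊤ := type_eq_one_iff.1 hP
    have : Unique P.Elem := ⟨⟨⊥⟩, fun x => le_antisymm (h ▸ le_top) bot_le⟩
    rw [if_pos hP, map_one, Fintype.sum_unique, Subsingleton.elim default (⊥ : P.Elem), ← h,
      itvType_self, rightInv, if_pos rfl, map_one, one_mul]
  · have key : rightInv (k := k) (type P) = - ∑ x : P.Elem, (if typeCard (itvType P x ⊤) < typeCard (type P) then of k (itvType P ⊥ x) * rightInv (k := k) (itvType P x ⊤) else 0) := by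
      rw [rightInv, if_neg hP, sumType_type]
    rw [if_neg hP, map_zero, ← Finset.sum_erase_add _ _ (Finset.mem_univ (⊥ : P.Elem)),
      itvType_bot_top, itvType_self, map_one, one_mul, key,
      ← Finset.sum_erase_add _ _ (Finset.mem_univ (⊥ : P.Elem)), itvType_bot_top,
      if_neg (lt_irrefl _), add_zero, ← sub_eq_add_neg, sub_eq_zero]
    refine Finset.sum_congr rfl fun x hx => ?_
    rw [if_pos]
    rw [itvType_of_le _ le_top]
    exact card_upper_lt (Finset.ne_of_mem_erase hx)

theorem leftInv_conv : WithConv.toConv (linearLift (k := k) (leftInv (k := k) (𝓕 := 𝓕))) *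
    WithConv.toConv LinearMap.id = 1 := by
  refine WithConv.ext (linearMap_ext fun P => ?_)
  refine Eq.trans ?_ (sum_leftInv P)
  have := congrArg (LinearMap.mul' k _ ∘ₗ TensorProduct.map
    (linearLift (k := k) (leftInv (k := k) (𝓕 := 𝓕))) LinearMap.id) (comul_of (k := k) P)
  refine this.trans ?_
  simp [linearLift_of]

theorem conv_rightInv : WithConv.toConv LinearMap.id *
    WithConv.toConv (linearLift (k := k) (rightInv (k := k) (𝓕 := 𝓕))) = 1 := by
  refine WithConv.ext (linearMap_ext fun P => ?_)
  refine Eq.trans ?_ (sum_rightInv P)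
  have := congrArg (LinearMap.mul' k _ ∘ₗ TensorProduct.map
    LinearMap.id (linearLift (k := k) (rightInv (k := k) (𝓕 := 𝓕)))) (comul_of (k := k) P)
  refine this.trans ?_
  simp [linearLift_of]

/-- The incidence Hopf algebra: its antipode is the (unique) two-sided convolution inverse of the
identity map. -/
noncomputable instance : HopfAlgebra k (IncidenceHopf k 𝓕) :=
  HopfAlgebra.ofConvInverse (linearLift (leftInv (k := k))) leftInv_conv
    (by
      rw [left_inv_eq_right_inv (leftInv_conv (k := k) (𝓕 := 𝓕)) conv_rightInv]
      exact conv_rightInv)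

end IncidenceHopf

namespace HereditaryFamily

variable {α : Type u} {𝓕 : HereditaryFamily α}

/-- `P` is decomposable if it is equivalent to a product of two non-singleton members. -/
def IsDecomposable (P : 𝓕.Obj) : Prop :=
  ∃ A B : 𝓕.Obj, ¬ A.IsPoint ∧ ¬ B.IsPoint ∧ 𝓕.rel P (𝓕.mul A B)

/-- The set `I(P)` of the elements `x ≠ 0, 1` such that `[0, x]` is indecomposable. -/
def indecomposables (P : 𝓕.Obj) : Set P.Elem :=
  {x | x ≠ ⊥ ∧ x ≠ ⊤ ∧ ¬ IsDecomposable (P.lower x)}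

/-- The center `Z(P)`: the elements `a` that have a complementary factor `a'`, that is,
`[0, a] ∩ [0, a'] = {0}` and `[0, a] [0, a'] ∼ P`. -/
def center (P : 𝓕.Obj) : Set P.Elem :=
  {a | ∃ a' : P.Elem, Set.Icc ⊥ a ∩ Set.Icc ⊥ a' = {⊥} ∧
    𝓕.rel (𝓕.mul (P.lower a) (P.lower a')) P}

open Classical in
/-- The prime center `Z'(P)`: the minimal nonzero elements of the center. -/
noncomputable def primeCenter (P : 𝓕.Obj) : Finset P.Elem :=
  Finset.univ.filter fun a => Minimal (fun x => x ∈ center P ∧ x ≠ ⊥) a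

open Classical in
/-- The maximal elements of a set of elements of `P`. -/
noncomputable def maximals {P : 𝓕.Obj} (G : Finset P.Elem) : Finset P.Elem :=
  G.filter fun a => Maximal (· ∈ G) a

/-- `b` is a predecessor of `a` in `F`: `b ∈ F`, `b < a`, and no element of `F` is strictly
between `b` and `a`. -/
def IsPredecessor {P : 𝓕.Obj} (F : Finset P.Elem) (b a : P.Elem) : Prop :=
  b ∈ F ∧ b < a ∧ ∀ c ∈ F, ¬ (b < c ∧ c < a)

open Classical in
/-- The set of the predecessors of `a` in `F`. -/
noncomputable def predecessors {P : 𝓕.Obj} (F : Finset P.Elem) (a : P.Elem) : Finset P.Elem :=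
  F.filter fun b => IsPredecessor F b a

theorem predecessors_subset {P : 𝓕.Obj} (F : Finset P.Elem) (a : P.Elem) :
    predecessors F a ⊆ F := by
  classical
  exact Finset.filter_subset _ _

/-- A forest `(F, J)` of `P`: a set `F ⊆ I(P)` with a join-substitute `J : 2^F → P ∖ {1}`,
which extends the identity on `F`, has the product property and is monotone. -/
structure Forest (P : 𝓕.Obj) where
  F : Finset P.Elem
  J : {G : Finset P.Elem // G ⊆ F} → P.Elem
  mem_indecomposables : ∀ a ∈ F, a ∈ indecomposables P
  J_ne_top : ∀ G, J G ≠ ⊤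
  J_singleton : ∀ a (ha : {a} ⊆ F), J ⟨{a}, ha⟩ = a
  nonoverlapping : ∀ a ∈ F, ∀ b ∈ F, a ≤ b ∨ b ≤ a ∨ Set.Icc ⊥ a ∩ Set.Icc ⊥ b = {⊥}
  type_J : ∀ G, type (P.lower (J G)) = ∏ a ∈ maximals G.1, type (P.lower a)
  J_mono : ∀ G' G, G'.1 ⊆ G.1 → J G' ≤ J G

namespace Forest

variable {P : 𝓕.Obj}

instance : Finite (Forest P) :=
  Finite.of_injective
    (fun T : Forest P =>
      (⟨T.F, T.J⟩ : Σ F : Finset P.Elem, ({G : Finset P.Elem // G ⊆ F} → P.Elem)))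
    (by
      rintro ⟨F, J, _⟩ ⟨F', J', _⟩ h
      obtain ⟨rfl, h⟩ := Sigma.mk.inj h
      obtain rfl := eq_of_heq h
      rfl)

noncomputable instance : Fintype (Forest P) := Fintype.ofFinite _

/-- The element `ã = J(predecessors of a)`. -/
noncomputable def tilde (T : Forest P) (a : P.Elem) : P.Elem :=
  T.J ⟨predecessors T.F a, predecessors_subset T.F a⟩

/-- The class `Θ(F, J)` of the product of the intervals `[ã, a]` over `a ∈ F ∪ Z'(P)`. -/
noncomputable def theta (T : Forest P) : 𝓕.Types :=
  ∏ a ∈ T.F ∪ primeCenter P, itvType P (T.tilde a) a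

/-- The number `d(F) = |F| + 1`. -/
def d (T : Forest P) : ℕ := T.F.card + 1

end Forest

end HereditaryFamily

/-! Allow forests to contain the greatest element and let `J` take it as a value (`PreForest`). Give
such a forest the weight (-1)^|F| ∏ [ã, a], the product running over a ∈ F, and let w(x) be the sum
of the weights of the forests with J(F) = x. Then w(x) = χ([0, x]) for every x
(`weightSum_eq_antipode`), by induction on x. If [0, x] is a product [0, p] × [0, q], a forest below
x is a pair of forests below p and q, so w(x) = w(p) w(q), and χ is multiplicative. If [0, x] is
indecomposable, a forest with J(F) = x contains x; deleting x leaves an arbitrary forest with J(F) <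
x and removes the factor -[J(F), x], so w(x) = -∑ w(y) [y, x] over y < x, which is the recursion for
χ.

Now adjoin the prime center: let the product run over F ∪ Z'(P). The total over all forests is zero
(`sum_weight_primeCenter`): for a ∈ Z'(P), P splits as [0, a] times a complement, the total factors
accordingly, and in the factor [0, a] inserting or deleting a cancels everything. Forests with J(F)
= 1 already contain Z'(P), so together they contribute w(1) = χ(P); the others are exactly the
forests of P, and moving them across the equation supplies the sign in d(F) = |F| + 1.

All this needs products inside P. The axiom on intervals equivalent to a product turns a
factorization of the class of [0, x] into elements p, q ≤ x (`exists_isSplit`). The map J is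
constrained only through classes, so one must know that classes determine elements. The tool is
unique factorization of classes (`irreducible_factorization_unique`) and its consequence
`IsFactorSet.eq_of_prod_eq`: pairwise disjoint irreducible elements below x whose classes multiply
to that of [0, x] are the irreducible factors of x. Hence the maximal elements of G are the factors
of J(G), and J respects splittings. -/

namespace HereditaryFamily

open IncidenceHopf (typeCard)

variable {α : Type u} {𝓕 : HereditaryFamily α}

/-! ### Unique factorization of classes -/

/-- A class of intervals that is not trivial and not a product of two nontrivial classes. -/
def IsIrreducibleType (m : 𝓕.Types) : Prop := m ≠ 1 ∧ ∀ a b, m = a * b → a = 1 ∨ b = 1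

theorem exists_elem_of_type_eq_mul {X : 𝓕.Obj} {m n : 𝓕.Types} (h : type X = m * n) :
    ∃ z : X.Elem, itvType X ⊥ z = m ∧ itvType X z ⊤ = n := by
  obtain ⟨A, rfl⟩ := type_surjective m
  obtain ⟨B, rfl⟩ := type_surjective n
  rw [← type_mul] at h
  obtain ⟨e, he⟩ := exists_bij_type h.symm
  obtain ⟨f, hf⟩ := exists_prod_type A B
  refine ⟨e (f (⊤, ⊥)), ?_⟩
  rw [← (he _).1, ← (he _).2, (hf _ _).1, (hf _ _).2]
  simp only [itvType_bot_top, itvType_self, mul_one, one_mul, and_self]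

/-- Equivalence gives only a bijection preserving the classes of lower and upper intervals, not the
order; the coordinates of `z` are therefore meaningful only through these classes. -/
theorem exists_pair_of_type_eq_mul {X A B : 𝓕.Obj} (h : type X = type A * type B) (z : X.Elem) :
    ∃ (x : A.Elem) (y : B.Elem), itvType X ⊥ z = itvType A ⊥ x * itvType B ⊥ y ∧
      itvType X z ⊤ = itvType A x ⊤ * itvType B y ⊤ := by
  rw [← type_mul] at h
  obtain ⟨e, he⟩ := exists_bij_type h
  obtain ⟨f, hf⟩ := exists_prod_type A B
  refine ⟨(f.symm (e z)).1, (f.symm (e z)).2, ?_⟩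
  rw [(he z).1, (he z).2, ← (hf _ _).1, ← (hf _ _).2]
  simp

theorem exists_incl {P : 𝓕.Obj} {x y : P.Elem} (h : y ≤ x) :
    ∃ z : (P.lower x).Elem, incl P bot_le z = y :=
  ⟨⟨y.1, (FinInterval.mem_sub (P := P.1) (x := ⊥) (h := bot_le)).2 ⟨P.1.bot_le _ y.2, h⟩⟩, rfl⟩

theorem incl_lower_le {P : 𝓕.Obj} {x : P.Elem} (z : (P.lower x).Elem) :
    incl P (bot_le : ⊥ ≤ x) z ≤ x :=
  ((FinInterval.mem_sub (P := P.1) (x := ⊥) (h := bot_le)).1 z.2).2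

theorem typeCard_lower_lt {X : 𝓕.Obj} {x y : X.Elem} (h : x < y) :
    typeCard (itvType X ⊥ x) < typeCard (itvType X ⊥ y) := by
  obtain ⟨z, rfl⟩ := exists_incl h.le
  have hz : itvType X ⊥ (incl X bot_le z) = itvType (X.lower y) ⊥ z :=
    (itvType_itv X bot_le ⊥ z).symm
  rw [hz, itvType_of_le _ bot_le, itvType_of_le _ bot_le]
  refine IncidenceHopf.card_lower_lt fun h' => h.ne ?_
  rw [h', incl_top]

theorem typeCard_lower_le {X : 𝓕.Obj} {x y : X.Elem} (h : x ≤ y) :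
    typeCard (itvType X ⊥ x) ≤ typeCard (itvType X ⊥ y) := by
  rcases h.lt_or_eq with h | rfl
  · exact (typeCard_lower_lt h).le
  · exact le_rfl

theorem eq_of_le_of_typeCard_le {X : 𝓕.Obj} {x y : X.Elem} (h : x ≤ y)
    (h' : typeCard (itvType X ⊥ y) ≤ typeCard (itvType X ⊥ x)) : x = y := by
  by_contra hne
  exact absurd (typeCard_lower_lt (lt_of_le_of_ne h hne)) (not_lt.2 h')

theorem itvType_bot_eq_one_iff {X : 𝓕.Obj} {x : X.Elem} : itvType X ⊥ x = 1 ↔ x = ⊥ := by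
  rw [itvType_eq_one_iff _ bot_le, eq_comm]

/-- The inductive step of unique factorization. In a product, `z` has two coordinates, and
irreducibility makes one of them least. If the head coordinate is least, recurse into the rest;
otherwise the size bound forces that coordinate to be the greatest element of the head factor, so
the head is the class of `[⊥, z]`. -/
theorem exists_cons_of_irreducible (t : Multiset 𝓕.Types) : ∀ (X : 𝓕.Obj) (_ : type X = t.prod)
    (z : X.Elem) (_ : IsIrreducibleType (itvType X ⊥ z))
    (_ : ∀ a ∈ t, typeCard a ≤ typeCard (itvType X ⊥ z)),
    ∃ t', t = itvType X ⊥ z ::ₘ t' ∧ itvType X z ⊤ = t'.prod := by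
  induction t using Multiset.induction with
  | empty =>
    intro X hX z hz _
    rw [Multiset.prod_zero, type_eq_one_iff] at hX
    refine absurd (itvType_bot_eq_one_iff.2 (le_bot_iff.1 ?_)) hz.1
    rw [hX]
    exact le_top
  | cons a t ih =>
    intro X hX z hz hcard
    obtain ⟨A, rfl⟩ := type_surjective a
    obtain ⟨B, hB⟩ := type_surjective t.prod
    rw [Multiset.prod_cons, ← hB] at hX
    obtain ⟨x, y, h1, h2⟩ := exists_pair_of_type_eq_mul hX z
    rcases hz.2 _ _ h1 with h | h
    · rw [h, one_mul] at h1
      rw [itvType_bot_eq_one_iff] at h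
      obtain ⟨t', rfl, ht'⟩ := ih B hB y (h1 ▸ hz)
        fun a ha => h1 ▸ hcard a (Multiset.mem_cons_of_mem ha)
      refine ⟨type A ::ₘ t', ?_, ?_⟩
      · rw [h1, Multiset.cons_swap]
      · rw [h2, h, itvType_bot_top, ht', Multiset.prod_cons]
    · rw [h, mul_one] at h1
      rw [itvType_bot_eq_one_iff] at h
      have hx : x = ⊤ := eq_of_le_of_typeCard_le le_top (by
        rw [itvType_bot_top, ← h1]
        exact hcard _ (Multiset.mem_cons_self _ _))
      subst hx
      subst h
      rw [itvType_bot_top] at h1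
      refine ⟨t, by rw [h1], ?_⟩
      rw [h2, itvType_self, itvType_bot_top, one_mul, hB]

/-- Factorization of classes into irreducible classes is unique. -/
theorem irreducible_factorization_unique (n : ℕ) : ∀ (s t : Multiset 𝓕.Types)
    (_ : s.card + t.card = n) (_ : ∀ m ∈ s, IsIrreducibleType m)
    (_ : ∀ m ∈ t, IsIrreducibleType m) (_ : s.prod = t.prod), s = t := by
  induction n using Nat.strong_induction_on with
  | _ n ih =>
  -- Cancellation in the monoid of classes is not available. Instead one element `z` with `[⊥, z]`
  -- of class `m` and `[z, ⊤]` of class `s'.prod` is located in the other factorization, which also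
  -- computes `[z, ⊤]` as `t'.prod`.
  have key : ∀ (s t : Multiset 𝓕.Types) (_ : s.card + t.card = n)
      (_ : ∀ m ∈ s, IsIrreducibleType m) (_ : ∀ m ∈ t, IsIrreducibleType m)
      (_ : s.prod = t.prod), ∀ m ∈ s, (∀ a ∈ t, typeCard a ≤ typeCard m) → s = t := by
    intro s t hn hs ht h m hm hmax
    obtain ⟨s', rfl⟩ := Multiset.exists_cons_of_mem hm
    rw [Multiset.prod_cons] at h
    obtain ⟨X, hX⟩ := type_surjective t.prod
    obtain ⟨z, h1, h2⟩ := exists_elem_of_type_eq_mul (hX.trans h.symm)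
    obtain ⟨t', rfl, ht'⟩ := exists_cons_of_irreducible t X hX z (h1 ▸ hs m hm)
      (by rw [h1]; exact hmax)
    rw [h1] at *
    rw [ih (s'.card + t'.card) (by simp only [Multiset.card_cons] at hn; omega) s' t' rfl
      (fun a ha => hs a (Multiset.mem_cons_of_mem ha))
      (fun a ha => ht a (Multiset.mem_cons_of_mem ha)) (h2.symm.trans ht')]
  intro s t hn hs ht h
  by_cases hst : s + t = 0
  · rw [add_eq_zero] at hst
    rw [hst.1, hst.2]
  classical
  -- A factor of largest size on either side satisfies the size bound of `key`.
  obtain ⟨m, hm, hmax⟩ := Finset.exists_max_image (s + t).toFinset typeCard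
    (by rwa [Multiset.toFinset_nonempty])
  simp only [Multiset.mem_toFinset, Multiset.mem_add] at hm hmax
  rcases hm with hm | hm
  · exact key s t hn hs ht h m hm fun a ha => hmax a (Or.inr ha)
  · exact (key t s (by omega) ht hs h.symm m hm fun a ha => hmax a (Or.inl ha)).symm

/-! ### Product decompositions of lower intervals inside `P` -/

/-- The class of the lower interval `[0, x]`. -/
noncomputable def lowerType {P : 𝓕.Obj} (x : P.Elem) : 𝓕.Types := itvType P ⊥ x

theorem lowerType_bot {P : 𝓕.Obj} : lowerType (⊥ : P.Elem) = 1 := itvType_self _ _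

theorem lowerType_eq_one_iff {P : 𝓕.Obj} {x : P.Elem} : lowerType x = 1 ↔ x = ⊥ :=
  itvType_bot_eq_one_iff

theorem type_lower (P : 𝓕.Obj) (x : P.Elem) : type (P.lower x) = lowerType x :=
  (itvType_of_le _ _).symm

/-- The element `x` is not the least one and its lower interval is indecomposable. -/
def IsIrr {P : 𝓕.Obj} (x : P.Elem) : Prop := IsIrreducibleType (lowerType x)

theorem IsIrr.ne_bot {P : 𝓕.Obj} {x : P.Elem} (h : IsIrr x) : x ≠ ⊥ :=
  fun h' => h.1 (lowerType_eq_one_iff.2 h')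

theorem isIrr_iff {P : 𝓕.Obj} {x : P.Elem} : IsIrr x ↔ x ≠ ⊥ ∧ ¬ IsDecomposable (P.lower x) := by
  unfold IsIrr IsIrreducibleType
  rw [Ne, lowerType_eq_one_iff]
  refine and_congr_right fun _ => ⟨?_, ?_⟩
  · rintro h ⟨A, B, hA, hB, hAB⟩
    rw [← type_eq_iff, type_lower, type_mul] at hAB
    rcases h _ _ hAB with h | h
    · exact hA (type_eq_one_iff.1 h)
    · exact hB (type_eq_one_iff.1 h)
  · intro h a b hab
    obtain ⟨A, rfl⟩ := type_surjective a
    obtain ⟨B, rfl⟩ := type_surjective b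
    by_contra! hne
    simp only [Ne, type_eq_one_iff] at hne
    refine h ⟨A, B, hne.1, hne.2, ?_⟩
    rw [← type_eq_iff, type_lower, type_mul, hab]

variable {P : 𝓕.Obj}

/-- The map `j` identifies `[0, p] × [0, q]` with `[0, x]`, compatibly with lower intervals. -/
structure IsSplit (x p q : P.Elem) (j : P.Elem → P.Elem → P.Elem) : Prop where
  join_le : ∀ u ≤ p, ∀ v ≤ q, j u v ≤ x
  join_le_join : ∀ u ≤ p, ∀ v ≤ q, ∀ u' ≤ p, ∀ v' ≤ q, j u v ≤ j u' v' ↔ u ≤ u' ∧ v ≤ v'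
  join_bot : ∀ u ≤ p, j u ⊥ = u
  bot_join : ∀ v ≤ q, j ⊥ v = v
  exists_join : ∀ y ≤ x, ∃ u ≤ p, ∃ v ≤ q, j u v = y
  lowerType_join : ∀ u ≤ p, ∀ v ≤ q, lowerType (j u v) = lowerType u * lowerType v

namespace IsSplit

variable {x p q : P.Elem} {j : P.Elem → P.Elem → P.Elem}

theorem symm (h : IsSplit x p q j) : IsSplit x q p fun u v => j v u where
  join_le u hu v hv := h.join_le v hv u hu
  join_le_join u hu v hv u' hu' v' hv' := (h.join_le_join v hv u hu v' hv' u' hu').trans and_comm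
  join_bot := h.bot_join
  bot_join := h.join_bot
  exists_join y hy := by
    obtain ⟨u, hu, v, hv, rfl⟩ := h.exists_join y hy
    exact ⟨v, hv, u, hu, rfl⟩
  lowerType_join u hu v hv := (h.lowerType_join v hv u hu).trans (_root_.mul_comm _ _)

theorem left_le (h : IsSplit x p q j) : p ≤ x := by
  rw [← h.join_bot p le_rfl]
  exact h.join_le p le_rfl ⊥ bot_le

theorem right_le (h : IsSplit x p q j) : q ≤ x := h.symm.left_le

theorem join_top (h : IsSplit x p q j) : j p q = x := by
  obtain ⟨u, hu, v, hv, rfl⟩ := h.exists_join x le_rfl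
  exact le_antisymm (h.join_le p le_rfl q le_rfl)
    ((h.join_le_join u hu v hv p le_rfl q le_rfl).2 ⟨hu, hv⟩)

theorem join_inj (h : IsSplit x p q j) {u v u' v' : P.Elem} (hu : u ≤ p) (hv : v ≤ q)
    (hu' : u' ≤ p) (hv' : v' ≤ q) (he : j u v = j u' v') : u = u' ∧ v = v' := by
  have h1 := (h.join_le_join u hu v hv u' hu' v' hv').1 he.le
  have h2 := (h.join_le_join u' hu' v' hv' u hu v hv).1 he.ge
  exact ⟨le_antisymm h1.1 h2.1, le_antisymm h1.2 h2.2⟩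

theorem le_join_iff_left (h : IsSplit x p q j) {w u v : P.Elem} (hw : w ≤ p) (hu : u ≤ p)
    (hv : v ≤ q) : w ≤ j u v ↔ w ≤ u := by
  conv_lhs => rw [← h.join_bot w hw]
  rw [h.join_le_join w hw ⊥ bot_le u hu v hv]
  simp

theorem le_join_iff_right (h : IsSplit x p q j) {w u v : P.Elem} (hw : w ≤ q) (hu : u ≤ p)
    (hv : v ≤ q) : w ≤ j u v ↔ w ≤ v := h.symm.le_join_iff_left hw hv hu

theorem disjoint (h : IsSplit x p q j) {w : P.Elem} (hp : w ≤ p) (hq : w ≤ q) : w = ⊥ := by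
  have := (h.le_join_iff_left (v := q) hp bot_le le_rfl).1 (by rwa [h.bot_join q le_rfl])
  exact le_bot_iff.1 this

theorem lowerType_eq (h : IsSplit x p q j) : lowerType x = lowerType p * lowerType q := by
  rw [← h.lowerType_join p le_rfl q le_rfl, h.join_top]

theorem restrict (h : IsSplit x p q j) {u v : P.Elem} (hu : u ≤ p) (hv : v ≤ q) :
    IsSplit (j u v) u v j where
  join_le a ha b hb := (h.join_le_join a (ha.trans hu) b (hb.trans hv) u hu v hv).2 ⟨ha, hb⟩
  join_le_join a ha b hb a' ha' b' hb' := h.join_le_join a (ha.trans hu) b (hb.trans hv)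
    a' (ha'.trans hu) b' (hb'.trans hv)
  join_bot a ha := h.join_bot a (ha.trans hu)
  bot_join b hb := h.bot_join b (hb.trans hv)
  exists_join y hy := by
    obtain ⟨a, ha, b, hb, rfl⟩ := h.exists_join y (hy.trans (h.join_le u hu v hv))
    have := (h.join_le_join a ha b hb u hu v hv).1 hy
    exact ⟨a, this.1, b, this.2, rfl⟩
  lowerType_join a ha b hb := h.lowerType_join a (ha.trans hu) b (hb.trans hv)

/-- The class of `[⊥, b]` is the product of the classes of the two coordinates of `b`, so one
coordinate is `⊥`. -/
theorem le_or_le (h : IsSplit x p q j) {b : P.Elem} (hb : IsIrr b) (hbx : b ≤ x) :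
    b ≤ p ∨ b ≤ q := by
  obtain ⟨u, hu, v, hv, rfl⟩ := h.exists_join b hbx
  rcases hb.2 _ _ (h.lowerType_join u hu v hv) with h' | h'
  · rw [lowerType_eq_one_iff] at h'
    subst h'
    right
    rwa [h.bot_join v hv]
  · rw [lowerType_eq_one_iff] at h'
    subst h'
    left
    rwa [h.join_bot u hu]

/-- A factor of a factor is a factor. -/
theorem assoc (h : IsSplit x p q j) {e r : P.Elem} {i : P.Elem → P.Elem → P.Elem}
    (h' : IsSplit p e r i) : ∃ j', IsSplit x e (j r q) j' := by
  have hrp := h'.right_le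
  have hr := h.restrict hrp (le_refl q)
  -- `f` and `g` are the coordinates of `w` in `[⊥, r] × [⊥, q]`; their values elsewhere play no
  -- role.
  have : ∀ w, ∃ a b, w ≤ j r q → a ≤ r ∧ b ≤ q ∧ j a b = w := fun w => by
    by_cases hw : w ≤ j r q
    · obtain ⟨a, ha, b, hb, hab⟩ := hr.exists_join w hw
      exact ⟨a, b, fun _ => ⟨ha, hb, hab⟩⟩
    · exact ⟨⊥, ⊥, fun h => absurd h hw⟩
  choose f g hfg using this
  have fg : ∀ a ≤ r, ∀ b ≤ q, f (j a b) = a ∧ g (j a b) = b := fun a ha b hb => by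
    obtain ⟨h1, h2, h3⟩ := hfg (j a b) (hr.join_le a ha b hb)
    exact hr.join_inj h1 h2 ha hb h3
  have fbot : f ⊥ = ⊥ ∧ g ⊥ = ⊥ := by
    have := fg ⊥ bot_le ⊥ bot_le
    rwa [hr.join_bot _ bot_le] at this
  refine ⟨fun u w => j (i u (f w)) (g w), ?_, ?_, ?_, ?_, ?_, ?_⟩
  · intro u hu w hw
    obtain ⟨h1, h2, -⟩ := hfg w hw
    exact h.join_le _ (h'.join_le u hu _ h1) _ h2
  · intro u hu w hw u' hu' w' hw'
    obtain ⟨h1, h2, h3⟩ := hfg w hw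
    obtain ⟨h1', h2', h3'⟩ := hfg w' hw'
    rw [h.join_le_join _ (h'.join_le u hu _ h1) _ h2 _ (h'.join_le u' hu' _ h1') _ h2',
      h'.join_le_join _ hu _ h1 _ hu' _ h1', and_assoc,
      ← hr.join_le_join _ h1 _ h2 _ h1' _ h2', h3, h3']
  · intro u hu
    rw [fbot.1, fbot.2, h'.join_bot u hu, h.join_bot u (hu.trans h'.left_le)]
  · intro w hw
    obtain ⟨h1, h2, h3⟩ := hfg w hw
    rw [h'.bot_join _ h1, h3]
  · intro y hy
    obtain ⟨a, ha, b, hb, rfl⟩ := h.exists_join y hy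
    obtain ⟨u, hu, v, hv, rfl⟩ := h'.exists_join a ha
    refine ⟨u, hu, j v b, hr.join_le v hv b hb, ?_⟩
    obtain ⟨h1, h2⟩ := fg v hv b hb
    simp only [h1, h2]
  · intro u hu w hw
    obtain ⟨h1, h2, h3⟩ := hfg w hw
    rw [h.lowerType_join _ (h'.join_le u hu _ h1) _ h2, h'.lowerType_join u hu _ h1, _root_.mul_assoc,
      ← h.lowerType_join _ (h1.trans hrp) _ h2, h3]

end IsSplit

theorem isSplit_bot_left (x : P.Elem) : IsSplit x ⊥ x fun _ v => v where
  join_le _ _ _ hv := hv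
  join_le_join u hu v hv u' hu' v' hv' := by simp [le_bot_iff.1 hu]
  join_bot u hu := (le_bot_iff.1 hu).symm
  bot_join _ _ := rfl
  exists_join y hy := ⟨⊥, le_rfl, y, hy, rfl⟩
  lowerType_join u hu v hv := by rw [le_bot_iff.1 hu, lowerType_bot, one_mul]

theorem lowerType_incl {x : P.Elem} (z : (P.lower x).Elem) :
    lowerType (incl P bot_le z) = itvType (P.lower x) ⊥ z :=
  (itvType_itv P bot_le ⊥ z).symm

/-- A factorization of the class of `[0, x]` is realized by elements below `x`. -/
theorem exists_isSplit {x : P.Elem} {m n : 𝓕.Types} (h : lowerType x = m * n) :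
    ∃ p q j, IsSplit x p q j ∧ lowerType p = m ∧ lowerType q = n := by
  obtain ⟨A, rfl⟩ := type_surjective m
  obtain ⟨B, rfl⟩ := type_surjective n
  -- Realization of a product inside an equivalent interval is an axiom only for factors with more
  -- than one element, so trivial factors are treated apart.
  by_cases hA : A.IsPoint
  · rw [type_eq_one_iff.2 hA, one_mul] at h
    exact ⟨⊥, x, _, isSplit_bot_left x, by rw [type_eq_one_iff.2 hA, lowerType_bot], h⟩
  by_cases hB : B.IsPoint
  · rw [type_eq_one_iff.2 hB, mul_one] at h
    exact ⟨x, ⊥, _, (isSplit_bot_left x).symm, h, by rw [type_eq_one_iff.2 hB, lowerType_bot]⟩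
  rw [← type_lower, ← type_mul, type_eq_iff] at h
  obtain ⟨ψ, hψ⟩ := 𝓕.exists_prod_of_rel A B (P.lower x) hA hB h
  -- An order embedding with image `[⊥, x]`; the two factors are the axes `f (·, ⊥)` and `f (⊥, ·)`,
  -- and `j` recombines coordinates through the partial inverse `g`.
  let f : A.Elem × B.Elem → P.Elem := fun z => incl P bot_le (ψ z)
  have f_le : ∀ z z', f z ≤ f z' ↔ z ≤ z' := fun z z' =>
    (incl_le_incl P _).trans ψ.le_iff_le
  have f_inj : Function.Injective f := fun z z' hz =>
    le_antisymm ((f_le _ _).1 hz.le) ((f_le _ _).1 hz.ge)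
  have f_le_x : ∀ z, f z ≤ x := fun z => incl_lower_le _
  have f_surj : ∀ y ≤ x, ∃ z, f z = y := fun y hy => by
    obtain ⟨z, rfl⟩ := exists_incl hy
    exact ⟨ψ.symm z, by simp [f]⟩
  have f_bot : f (⊥, ⊥) = ⊥ := by
    obtain ⟨z, hz⟩ := f_surj ⊥ bot_le
    refine le_bot_iff.1 ?_
    rw [← hz, f_le]
    exact ⟨bot_le, bot_le⟩
  have f_type : ∀ a b, lowerType (f (a, b)) = itvType A ⊥ a * itvType B ⊥ b := fun a b => by
    rw [lowerType_incl, itvType_of_le _ bot_le, itvType_of_le _ bot_le, itvType_of_le _ bot_le,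
      ← type_mul, type_eq_iff]
    exact (hψ a b).1
  have : ∀ y, ∃ z, y ≤ x → f z = y := fun y => by
    by_cases hy : y ≤ x
    · obtain ⟨z, hz⟩ := f_surj y hy
      exact ⟨z, fun _ => hz⟩
    · exact ⟨(⊥, ⊥), fun h => absurd h hy⟩
  choose g hg using this
  have gf : ∀ z, g (f z) = z := fun z => f_inj (hg _ (f_le_x z))
  have left : ∀ u ≤ f (⊤, ⊥), ∃ a, u = f (a, ⊥) := fun u hu => by
    obtain ⟨⟨a, b⟩, rfl⟩ := f_surj u (hu.trans (f_le_x _))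
    have : b = ⊥ := le_bot_iff.1 ((f_le _ _).1 hu).2
    exact ⟨a, by rw [this]⟩
  have right : ∀ v ≤ f (⊥, ⊤), ∃ b, v = f (⊥, b) := fun u hu => by
    obtain ⟨⟨a, b⟩, rfl⟩ := f_surj u (hu.trans (f_le_x _))
    have : a = ⊥ := le_bot_iff.1 ((f_le _ _).1 hu).1
    exact ⟨b, by rw [this]⟩
  have gbot : g ⊥ = (⊥, ⊥) := by rw [← f_bot, gf]
  refine ⟨f (⊤, ⊥), f (⊥, ⊤), fun u v => f ((g u).1, (g v).2), ⟨?_, ?_, ?_, ?_, ?_, ?_⟩, ?_, ?_⟩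
  · intro u _ v _
    exact f_le_x _
  · intro u hu v hv u' hu' v' hv'
    obtain ⟨a, rfl⟩ := left u hu
    obtain ⟨b, rfl⟩ := right v hv
    obtain ⟨a', rfl⟩ := left u' hu'
    obtain ⟨b', rfl⟩ := right v' hv'
    simp only [gf, f_le, Prod.mk_le_mk, le_refl, and_true, true_and]
  · intro u hu
    obtain ⟨a, rfl⟩ := left u hu
    simp only [gf, gbot]
  · intro v hv
    obtain ⟨b, rfl⟩ := right v hv
    simp only [gf, gbot]
  · intro y hy
    obtain ⟨⟨a, b⟩, rfl⟩ := f_surj y hy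
    refine ⟨f (a, ⊥), (f_le _ _).2 ⟨le_top, le_rfl⟩, f (⊥, b), (f_le _ _).2 ⟨le_rfl, le_top⟩, ?_⟩
    simp only [gf]
  · intro u hu v hv
    obtain ⟨a, rfl⟩ := left u hu
    obtain ⟨b, rfl⟩ := right v hv
    simp only [gf, f_type, itvType_self, mul_one, one_mul]
  · rw [f_type, itvType_self, itvType_bot_top, mul_one]
  · rw [f_type, itvType_self, itvType_bot_top, one_mul]

/-- The class fixes the number of elements of a lower interval. This is how an inequality from
monotonicity becomes an equality. -/
theorem eq_of_le_of_lowerType_eq {x y : P.Elem} (h : x ≤ y) (h' : lowerType y = lowerType x) :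
    x = y := eq_of_le_of_typeCard_le h (congrArg typeCard h').le

theorem IsSplit.disjoint_of_le {x p q : P.Elem} {j : P.Elem → P.Elem → P.Elem}
    (h : IsSplit x p q j) {a b : P.Elem} (ha : a ≤ p) (hb : b ≤ q) : Disjoint a b :=
  fun _ hwa hwb => (h.disjoint (hwa.trans ha) (hwb.trans hb)).le

/-! ### Irreducible factors of an element, and the prime center -/

/-- The elements of `E` are the irreducible factors of `x`. -/
structure IsFactorSet (x : P.Elem) (E : Finset P.Elem) : Prop where
  isIrr : ∀ e ∈ E, IsIrr e
  le : ∀ e ∈ E, e ≤ x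
  disjoint : ∀ a ∈ E, ∀ b ∈ E, a ≠ b → Disjoint a b
  prod : ∏ e ∈ E, lowerType e = lowerType x
  cover : ∀ b ≤ x, IsIrr b → ∃ e ∈ E, b ≤ e
  exists_isSplit : ∀ e ∈ E, ∃ q j, IsSplit x e q j

theorem isFactorSet_bot : IsFactorSet (⊥ : P.Elem) ∅ where
  isIrr := by simp
  le := by simp
  disjoint := by simp
  prod := by rw [Finset.prod_empty, lowerType_bot]
  cover b hb hb' := absurd (le_bot_iff.1 hb) hb'.ne_bot
  exists_isSplit := by simp

theorem isFactorSet_singleton {a : P.Elem} (ha : IsIrr a) : IsFactorSet a {a} where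
  isIrr := by simpa
  le := by simp
  disjoint b hb c hc hbc := by
    rw [Finset.mem_singleton] at hb hc
    exact absurd (hb.trans hc.symm) hbc
  prod := by rw [Finset.prod_singleton]
  cover b hb _ := ⟨a, by simp, hb⟩
  exists_isSplit e he := by
    rw [Finset.mem_singleton] at he
    subst he
    exact ⟨⊥, _, (isSplit_bot_left e).symm⟩

theorem IsSplit.disjoint_finset {x p q : P.Elem} {j : P.Elem → P.Elem → P.Elem}
    (h : IsSplit x p q j) {A B : Finset P.Elem} (hA : ∀ a ∈ A, a ≤ p ∧ a ≠ ⊥)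
    (hB : ∀ b ∈ B, b ≤ q) : Disjoint A B :=
  Finset.disjoint_left.2 fun a ha hb => (hA a ha).2 (h.disjoint (hA a ha).1 (hB a hb))

theorem IsFactorSet.union {x p q : P.Elem} {j : P.Elem → P.Elem → P.Elem} (h : IsSplit x p q j)
    {A B : Finset P.Elem} (hA : IsFactorSet p A) (hB : IsFactorSet q B) :
    IsFactorSet x (A ∪ B) where
  isIrr e he := (Finset.mem_union.1 he).elim (hA.isIrr e) (hB.isIrr e)
  le e he := (Finset.mem_union.1 he).elim (fun he => (hA.le e he).trans h.left_le)
    fun he => (hB.le e he).trans h.right_le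
  disjoint a ha b hb hab := by
    rcases Finset.mem_union.1 ha with ha | ha <;> rcases Finset.mem_union.1 hb with hb | hb
    · exact hA.disjoint a ha b hb hab
    · exact h.disjoint_of_le (hA.le a ha) (hB.le b hb)
    · exact h.symm.disjoint_of_le (hB.le a ha) (hA.le b hb)
    · exact hB.disjoint a ha b hb hab
  prod := by
    rw [Finset.prod_union (h.disjoint_finset (fun a ha => ⟨hA.le a ha, (hA.isIrr a ha).ne_bot⟩)
      hB.le), hA.prod, hB.prod, h.lowerType_eq]
  cover b hb hb' := by
    rcases h.le_or_le hb' hb with hb | hb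
    · obtain ⟨e, he, hbe⟩ := hA.cover b hb hb'
      exact ⟨e, Finset.mem_union_left _ he, hbe⟩
    · obtain ⟨e, he, hbe⟩ := hB.cover b hb hb'
      exact ⟨e, Finset.mem_union_right _ he, hbe⟩
  exists_isSplit e he := by
    rcases Finset.mem_union.1 he with he | he
    · obtain ⟨r, i, hi⟩ := hA.exists_isSplit e he
      exact ⟨_, h.assoc hi⟩
    · obtain ⟨r, i, hi⟩ := hB.exists_isSplit e he
      exact ⟨_, h.symm.assoc hi⟩

/-- An element is the least one, or irreducible, or a product of two smaller elements. -/
theorem eq_bot_or_isIrr_or_exists_isSplit (x : P.Elem) :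
    x = ⊥ ∨ IsIrr x ∨ ∃ p q j, IsSplit x p q j ∧ p < x ∧ q < x := by
  by_cases hx : x = ⊥
  · exact Or.inl hx
  by_cases hx' : IsIrr x
  · exact Or.inr (Or.inl hx')
  right
  right
  unfold IsIrr IsIrreducibleType at hx'
  rw [Ne, lowerType_eq_one_iff] at hx'
  push Not at hx'
  obtain ⟨a, b, hab, ha, hb⟩ := hx' hx
  obtain ⟨p, q, j, h, rfl, rfl⟩ := exists_isSplit hab
  refine ⟨p, q, j, h, lt_of_le_of_ne h.left_le ?_, lt_of_le_of_ne h.right_le ?_⟩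
  · rintro rfl
    exact hb (lowerType_eq_one_iff.2 (h.disjoint h.right_le le_rfl))
  · rintro rfl
    exact ha (lowerType_eq_one_iff.2 (h.disjoint le_rfl h.left_le))

theorem exists_isFactorSet (x : P.Elem) : ∃ E, IsFactorSet x E := by
  induction x using WellFoundedLT.induction with
  | _ x ih =>
  rcases eq_bot_or_isIrr_or_exists_isSplit x with rfl | hx | ⟨p, q, j, h, hp, hq⟩
  · exact ⟨_, isFactorSet_bot⟩
  · exact ⟨_, isFactorSet_singleton hx⟩
  · obtain ⟨A, hA⟩ := ih p hp
    obtain ⟨B, hB⟩ := ih q hq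
    exact ⟨_, hA.union h hB⟩

/-- By unique factorization `D` and `E` carry the same multiset of classes, and the class determines
the size. -/
theorem card_filter_eq_of_prod_eq {D E : Finset P.Elem} (hD : ∀ d ∈ D, IsIrr d)
    (hE : ∀ e ∈ E, IsIrr e) (h : ∏ d ∈ D, lowerType d = ∏ e ∈ E, lowerType e) (n : ℕ) :
    (D.filter fun d => typeCard (lowerType d) = n).card =
      (E.filter fun d => typeCard (lowerType d) = n).card := by
  have hDE : D.val.map lowerType = E.val.map lowerType := by
    refine irreducible_factorization_unique _ _ _ rfl ?_ ?_ h
    · intro m hm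
      obtain ⟨d, hd, rfl⟩ := Multiset.mem_map.1 hm
      exact hD d hd
    · intro m hm
      obtain ⟨d, hd, rfl⟩ := Multiset.mem_map.1 hm
      exact hE d hd
  have := congrArg (Multiset.countP fun m => typeCard m = n) hDE
  rw [Multiset.countP_map, Multiset.countP_map] at this
  exact this

/-- Disjoint irreducible elements below `x` with the right product are the factors of `x`. -/
theorem IsFactorSet.eq_of_prod_eq {x : P.Elem} {D E : Finset P.Elem} (hE : IsFactorSet x E)
    (hD : ∀ d ∈ D, IsIrr d) (hle : ∀ d ∈ D, d ≤ x)
    (hdisj : ∀ a ∈ D, ∀ b ∈ D, a ≠ b → Disjoint a b)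
    (hprod : ∏ d ∈ D, lowerType d = lowerType x) : D = E := by
  set N := typeCard (lowerType x) + 1 with hN
  have hcard : ∀ d ≤ x, typeCard (lowerType d) < N := fun d hd =>
    Nat.lt_succ_of_le (typeCard_lower_le hd)
  -- Downward induction on the size of `[⊥, d]`; no element below `x` has size `N` or more, which
  -- starts it.
  have key : ∀ k d, N ≤ typeCard (lowerType d) + k → (d ∈ D ↔ d ∈ E) := by
    intro k
    induction k with
    | zero =>
      intro d hd
      refine iff_of_false (fun h => ?_) fun h => ?_
      · exact absurd (hcard d (hle d h)) (by omega)
      · exact absurd (hcard d (hE.le d h)) (by omega)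
    | succ k ih =>
      intro d hd
      have hsub : (D.filter fun a => typeCard (lowerType a) = typeCard (lowerType d)) ⊆
          E.filter fun a => typeCard (lowerType a) = typeCard (lowerType d) := by
        intro a ha
        rw [Finset.mem_filter] at ha ⊢
        refine ⟨?_, ha.2⟩
        -- If the factor `e` above `a` were strictly larger, it would lie in `D` by induction,
        -- against the disjointness of `a` and `e`.
        obtain ⟨e, he, hae⟩ := hE.cover a (hle a ha.1) (hD a ha.1)
        rcases hae.eq_or_lt with rfl | hlt
        · exact he
        · have h1 : typeCard (lowerType a) < typeCard (lowerType e) := typeCard_lower_lt hlt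
          have h2 := (ih e (by omega)).2 he
          exact absurd (le_bot_iff.1 (hdisj a ha.1 e h2 hlt.ne le_rfl hae)) (hD a ha.1).ne_bot
      -- Inclusion within one size class becomes equality by counting.
      have heq := Finset.eq_of_subset_of_card_le hsub
        (card_filter_eq_of_prod_eq hD hE.isIrr (hprod.trans hE.prod.symm) _).ge
      have := Finset.ext_iff.1 heq d
      simpa using this
  ext d
  exact key N d (Nat.le_add_left _ _)

/-- The elements of the prime center are irreducible factors of `P`. -/
theorem primeCenter_subset_of_isFactorSet {E : Finset P.Elem} (hE : IsFactorSet ⊤ E) :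
    primeCenter P ⊆ E := by
  classical
  intro a ha
  simp only [primeCenter, Finset.mem_filter, Finset.mem_univ, true_and] at ha
  obtain ⟨⟨⟨a', hdisj, hrel⟩, hne⟩, hmin⟩ := ha
  rw [← type_eq_iff, type_mul, type_lower, type_lower, ← itvType_bot_top] at hrel
  have hdisj : Disjoint a a' := fun w hw hw' => by
    have : w ∈ Set.Icc ⊥ a ∩ Set.Icc ⊥ a' := ⟨⟨bot_le, hw⟩, ⟨bot_le, hw'⟩⟩
    rw [hdisj] at this
    exact le_of_eq this
  obtain ⟨A, hA⟩ := exists_isFactorSet a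
  obtain ⟨A', hA'⟩ := exists_isFactorSet a'
  have hAA' : Disjoint A A' := Finset.disjoint_left.2 fun e he he' =>
    (hA.isIrr e he).ne_bot (le_bot_iff.1 (hdisj (hA.le e he) (hA'.le e he')))
  -- The complement `a'` is given only through disjointness and classes; uniqueness of the factor
  -- set makes the factors of `a` genuine factors of `⊤`.
  have hEq : A ∪ A' = E := by
    refine hE.eq_of_prod_eq ?_ (fun _ _ => le_top) ?_ ?_
    · exact fun e he => (Finset.mem_union.1 he).elim (hA.isIrr e) (hA'.isIrr e)
    · intro e he f hf hef
      rcases Finset.mem_union.1 he with he | he <;> rcases Finset.mem_union.1 hf with hf | hf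
      · exact hA.disjoint e he f hf hef
      · exact hdisj.mono (hA.le e he) (hA'.le f hf)
      · exact (hdisj.mono (hA.le f hf) (hA'.le e he)).symm
      · exact hA'.disjoint e he f hf hef
    · rw [Finset.prod_union hAA', hA.prod, hA'.prod]
      exact hrel
  have hne' : A.Nonempty := by
    rw [Finset.nonempty_iff_ne_empty]
    rintro rfl
    exact hne (lowerType_eq_one_iff.1 (by rw [← hA.prod, Finset.prod_empty]))
  obtain ⟨e, he⟩ := hne'
  have heE : e ∈ E := hEq ▸ Finset.mem_union_left _ he
  obtain ⟨q, j, h⟩ := hE.exists_isSplit e heE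
  have hec : e ∈ center P := by
    refine ⟨q, ?_, ?_⟩
    · ext w
      simp only [Set.mem_inter_iff, Set.mem_Icc, bot_le, true_and, Set.mem_singleton_iff]
      exact ⟨fun hw => h.disjoint hw.1 hw.2, by rintro rfl; simp⟩
    · rw [← type_eq_iff, type_mul, type_lower, type_lower, ← h.lowerType_eq]
      exact itvType_bot_top P
  -- A factor `e` of `a` is itself central, so minimality of `a` gives `a = e`.
  have := hmin ⟨hec, (hE.isIrr e heE).ne_bot⟩ (hA.le e he)
  rwa [le_antisymm this (hA.le e he)]

theorem primeCenter_nonempty (hP : ¬ P.IsPoint) : (primeCenter P).Nonempty := by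
  classical
  have htop : (⊤ : P.Elem) ∈ center P := by
    refine ⟨⊥, ?_, ?_⟩
    · ext w
      simp only [Set.mem_inter_iff, Set.mem_Icc, bot_le, le_top, true_and, le_bot_iff,
        Set.mem_singleton_iff]
    · rw [← type_eq_iff, type_mul, type_lower, type_lower, lowerType_bot, mul_one]
      exact itvType_bot_top P
  obtain ⟨a, -, ha⟩ := exists_minimal_le_of_wellFoundedLT
    (fun x : P.Elem => x ∈ center P ∧ x ≠ ⊥) ⊤ ⟨htop, fun h => hP h.symm⟩
  exact ⟨a, by simpa [primeCenter] using ha⟩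

/-! ### Maximal elements, and forests in the wider sense -/

theorem mem_maximals {G : Finset P.Elem} {a : P.Elem} :
    a ∈ maximals G ↔ a ∈ G ∧ ∀ b ∈ G, a ≤ b → b ≤ a := by
  classical
  unfold maximals
  rw [Finset.mem_filter]
  simp only [Maximal]
  tauto

theorem maximals_subset (G : Finset P.Elem) : maximals G ⊆ G := fun _ h => (mem_maximals.1 h).1

theorem maximals_maximals (G : Finset P.Elem) : maximals (maximals G) = maximals G := by
  refine Finset.Subset.antisymm (maximals_subset _) fun a ha => mem_maximals.2 ⟨ha, ?_⟩
  exact fun b hb hab => (mem_maximals.1 ha).2 b (maximals_subset _ hb) hab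

theorem maximals_empty : maximals (∅ : Finset P.Elem) = ∅ :=
  Finset.subset_empty.1 (maximals_subset _)

theorem maximals_eq_singleton {G : Finset P.Elem} {a : P.Elem} (ha : a ∈ G)
    (h : ∀ b ∈ G, b ≤ a) : maximals G = {a} := by
  ext b
  rw [mem_maximals, Finset.mem_singleton]
  constructor
  · rintro ⟨hb, hb'⟩
    exact le_antisymm (h b hb) (hb' a ha (h b hb))
  · rintro rfl
    exact ⟨ha, fun c hc _ => h c hc⟩

/-- Nonzero elements below `p` are incomparable to nonzero elements below `q`, so maximality is
decided within each part. -/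
theorem IsSplit.prod_maximals_union {x p q : P.Elem} {j : P.Elem → P.Elem → P.Elem}
    (h : IsSplit x p q j) {A B : Finset P.Elem} (hA : ∀ a ∈ A, a ≤ p ∧ a ≠ ⊥)
    (hB : ∀ b ∈ B, b ≤ q ∧ b ≠ ⊥) {M : Type*} [CommMonoid M] (f : P.Elem → M) :
    ∏ a ∈ maximals (A ∪ B), f a = (∏ a ∈ maximals A, f a) * ∏ b ∈ maximals B, f b := by
  rw [← Finset.prod_union]
  · congr 1
    ext c
    simp only [mem_maximals, Finset.mem_union]
    constructor
    · rintro ⟨hc | hc, hc'⟩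
      · exact Or.inl ⟨hc, fun b hb => hc' b (Or.inl hb)⟩
      · exact Or.inr ⟨hc, fun b hb => hc' b (Or.inr hb)⟩
    · rintro (⟨hc, hc'⟩ | ⟨hc, hc'⟩)
      · refine ⟨Or.inl hc, fun b hb hcb => ?_⟩
        rcases hb with hb | hb
        · exact hc' b hb hcb
        · exact absurd (h.disjoint (hA c hc).1 (hcb.trans (hB b hb).1)) (hA c hc).2
      · refine ⟨Or.inr hc, fun b hb hcb => ?_⟩
        rcases hb with hb | hb
        · exact absurd (h.disjoint (hcb.trans (hA b hb).1) (hB c hc).1) (hB c hc).2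
        · exact hc' b hb hcb
  · exact h.disjoint_finset (fun a ha => hA a (maximals_subset _ ha))
      fun b hb => (hB b (maximals_subset _ hb)).1

/-- The elements below `p`. -/
noncomputable def below (p : P.Elem) : Finset P.Elem := by
  classical exact Finset.univ.filter (· ≤ p)

theorem mem_below {a p : P.Elem} : a ∈ below p ↔ a ≤ p := by
  classical
  simp [below]

/-- A forest of `P`, where the greatest element is allowed in `F` and as a value of `J`. The map
`J` is defined on all sets, but depends on the elements of `F` only. -/
@[ext]
structure PreForest (P : 𝓕.Obj) where
  F : Finset P.Elem
  J : Finset P.Elem → P.Elem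
  isIrr : ∀ a ∈ F, IsIrr a
  nonoverlapping : ∀ a ∈ F, ∀ b ∈ F, a ≤ b ∨ b ≤ a ∨ Disjoint a b
  -- Makes `J` determined by its values on subsets of `F`, so that equality of forests is equality
  -- of `F` and `J`.
  J_inter : ∀ G, J (G ∩ F) = J G
  lowerType_J : ∀ G ⊆ F, lowerType (J G) = ∏ a ∈ maximals G, lowerType a
  J_singleton : ∀ a ∈ F, J {a} = a
  J_mono : ∀ G' G, G' ⊆ G → J G' ≤ J G

namespace PreForest

instance : Finite (PreForest P) :=
  Finite.of_injective (fun T : PreForest P => (T.F, T.J)) fun _ _ h =>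
    PreForest.ext (congrArg Prod.fst h) (congrArg Prod.snd h)

noncomputable instance : Fintype (PreForest P) := Fintype.ofFinite _

variable (T : PreForest P)

theorem le_J {a : P.Elem} {G : Finset P.Elem} (ha : a ∈ T.F) (haG : a ∈ G) : a ≤ T.J G := by
  rw [← T.J_singleton a ha]
  exact T.J_mono _ _ (Finset.singleton_subset_iff.2 haG)

theorem J_le_top (G : Finset P.Elem) : T.J G ≤ T.J T.F := by
  rw [← T.J_inter]
  exact T.J_mono _ _ Finset.inter_subset_right

theorem J_empty : T.J ∅ = ⊥ := by
  rw [← lowerType_eq_one_iff, T.lowerType_J _ (Finset.empty_subset _), maximals_empty,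
    Finset.prod_empty]

theorem disjoint_of_mem_maximals {G : Finset P.Elem} (hG : G ⊆ T.F) {a b : P.Elem}
    (ha : a ∈ maximals G) (hb : b ∈ maximals G) (hab : a ≠ b) : Disjoint a b := by
  rw [mem_maximals] at ha hb
  rcases T.nonoverlapping a (hG ha.1) b (hG hb.1) with h | h | h
  · exact absurd (le_antisymm h (ha.2 b hb.1 h)) hab
  · exact absurd (le_antisymm (hb.2 a ha.1 h) h) hab
  · exact h

/-- The condition on `J G` concerns classes only; uniqueness of the factor set identifies the
maximal elements themselves. -/
theorem maximals_eq {G : Finset P.Elem} (hG : G ⊆ T.F) {E : Finset P.Elem}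
    (hE : IsFactorSet (T.J G) E) : maximals G = E :=
  hE.eq_of_prod_eq (fun a ha => T.isIrr a (hG (maximals_subset _ ha)))
    (fun _ ha => T.le_J (hG (maximals_subset _ ha)) (maximals_subset _ ha))
    (fun _ ha _ hb hab => T.disjoint_of_mem_maximals hG ha hb hab) (T.lowerType_J G hG).symm

theorem J_maximals {G : Finset P.Elem} (hG : G ⊆ T.F) : T.J (maximals G) = T.J G :=
  eq_of_le_of_lowerType_eq (T.J_mono _ _ (maximals_subset _)) <| by
    rw [T.lowerType_J _ hG, T.lowerType_J _ ((maximals_subset _).trans hG), maximals_maximals]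

theorem J_eq_of_greatest {G : Finset P.Elem} (hG : G ⊆ T.F) {a : P.Elem} (ha : a ∈ G)
    (h : ∀ b ∈ G, b ≤ a) : T.J G = a := by
  rw [← T.J_maximals hG, maximals_eq_singleton ha h, T.J_singleton a (hG ha)]

theorem mem_of_J_eq {G : Finset P.Elem} (hG : G ⊆ T.F) {a : P.Elem} (ha : IsIrr a)
    (h : T.J G = a) : a ∈ G := by
  have := T.maximals_eq hG (isFactorSet_singleton (h.symm ▸ ha))
  exact maximals_subset _ (by rw [this, h]; exact Finset.mem_singleton_self a)

variable {x p q : P.Elem} {j : P.Elem → P.Elem → P.Elem}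

/-- The irreducible factors of the `q`-coordinate of `J G` are maximal elements of `G`, hence also
below `p`. There are none, so that coordinate is `⊥`. -/
theorem J_le_left (h : IsSplit x p q j) {G : Finset P.Elem} (hG : G ⊆ T.F) (hx : T.J G ≤ x)
    (hp : ∀ b ∈ G, b ≤ p) : T.J G ≤ p := by
  obtain ⟨u, hu, v, hv, huv⟩ := h.exists_join _ hx
  have h' := h.restrict hu hv
  obtain ⟨A, hA⟩ := exists_isFactorSet u
  obtain ⟨B, hB⟩ := exists_isFactorSet v
  have hmax := T.maximals_eq hG (huv ▸ hA.union h' hB)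
  have hB0 : B = ∅ := by
    rw [Finset.eq_empty_iff_forall_notMem]
    intro b hb
    have hbG : b ∈ G := maximals_subset _ (hmax ▸ Finset.mem_union_right _ hb)
    exact (hB.isIrr b hb).ne_bot (h.disjoint (hp b hbG) ((hB.le b hb).trans hv))
  have hv0 : v = ⊥ := by
    rw [← lowerType_eq_one_iff, ← hB.prod, hB0, Finset.prod_empty]
  rw [← huv, hv0, h.join_bot u hu]
  exact hu

theorem le_or_le (h : IsSplit x p q j) (hx : T.J T.F ≤ x) {b : P.Elem} (hb : b ∈ T.F) :
    b ≤ p ∨ b ≤ q := h.le_or_le (T.isIrr b hb) ((T.le_J hb hb).trans hx)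

theorem J_inter_below_le (h : IsSplit x p q j) (hx : T.J T.F ≤ x) (G : Finset P.Elem) :
    T.J (G ∩ below p) ≤ p := by
  rw [← T.J_inter]
  refine T.J_le_left h Finset.inter_subset_right ((T.J_le_top _).trans hx) fun b hb => ?_
  simp only [Finset.mem_inter, mem_below] at hb
  exact hb.1.2

/-- Monotonicity of `J` bounds the right side by the left, and both have the same class. -/
theorem J_eq_join (h : IsSplit x p q j) (hx : T.J T.F ≤ x) (G : Finset P.Elem) :
    T.J G = j (T.J (G ∩ below p)) (T.J (G ∩ below q)) := by
  have hp := T.J_inter_below_le h hx G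
  have hq := T.J_inter_below_le h.symm hx G
  obtain ⟨u, hu, v, hv, huv⟩ := h.exists_join (T.J G) ((T.J_le_top _).trans hx)
  have hu' : T.J (G ∩ below p) ≤ u := by
    rw [← h.le_join_iff_left hp hu hv, huv]
    exact T.J_mono _ _ Finset.inter_subset_left
  have hv' : T.J (G ∩ below q) ≤ v := by
    rw [← h.le_join_iff_right hq hu hv, huv]
    exact T.J_mono _ _ Finset.inter_subset_left
  symm
  rw [← huv]
  refine eq_of_le_of_lowerType_eq ((h.join_le_join _ hp _ hq u hu v hv).2 ⟨hu', hv'⟩) ?_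
  rw [huv, h.lowerType_join _ hp _ hq, ← T.J_inter, ← T.J_inter (G ∩ below p),
    ← T.J_inter (G ∩ below q), T.lowerType_J _ Finset.inter_subset_right,
    T.lowerType_J _ Finset.inter_subset_right, T.lowerType_J _ Finset.inter_subset_right,
    ← h.prod_maximals_union]
  · congr 2
    ext b
    simp only [Finset.mem_inter, Finset.mem_union, mem_below]
    constructor
    · rintro ⟨hb, hb'⟩
      exact (T.le_or_le h hx hb').imp (fun hbp => ⟨⟨hb, hbp⟩, hb'⟩) fun hbq => ⟨⟨hb, hbq⟩, hb'⟩
    · rintro (⟨⟨hb, -⟩, hb'⟩ | ⟨⟨hb, -⟩, hb'⟩) <;> exact ⟨hb, hb'⟩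
  · intro a ha
    simp only [Finset.mem_inter, mem_below] at ha
    exact ⟨ha.1.2, (T.isIrr a ha.2).ne_bot⟩
  · intro a ha
    simp only [Finset.mem_inter, mem_below] at ha
    exact ⟨ha.1.2, (T.isIrr a ha.2).ne_bot⟩

/-- The restriction of a forest to a set of elements. -/
noncomputable def restrict (E : Finset P.Elem) : PreForest P where
  F := T.F ∩ E
  J G := T.J (G ∩ E)
  isIrr a ha := T.isIrr a (Finset.mem_of_mem_inter_left ha)
  nonoverlapping a ha b hb := T.nonoverlapping a (Finset.mem_of_mem_inter_left ha) b
    (Finset.mem_of_mem_inter_left hb)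
  J_inter G := by
    rw [← T.J_inter (G ∩ E), ← T.J_inter]
    congr 1
    ext
    simp only [Finset.mem_inter]
    tauto
  lowerType_J G hG := by
    rw [Finset.inter_eq_left.2 (hG.trans Finset.inter_subset_right)]
    exact T.lowerType_J G (hG.trans Finset.inter_subset_left)
  J_singleton a ha := by
    rw [Finset.inter_eq_left.2 (Finset.singleton_subset_iff.2 (Finset.mem_of_mem_inter_right ha))]
    exact T.J_singleton a (Finset.mem_of_mem_inter_left ha)
  J_mono G' G hG := T.J_mono _ _ (Finset.inter_subset_inter_right hG)

/-- The forest that consists of forests of two factors. -/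
noncomputable def join (h : IsSplit x p q j) (T₁ T₂ : PreForest P) (h₁ : T₁.J T₁.F ≤ p)
    (h₂ : T₂.J T₂.F ≤ q) : PreForest P where
  F := T₁.F ∪ T₂.F
  J G := j (T₁.J G) (T₂.J G)
  isIrr a ha := (Finset.mem_union.1 ha).elim (T₁.isIrr a) (T₂.isIrr a)
  nonoverlapping a ha b hb := by
    rcases Finset.mem_union.1 ha with ha | ha <;> rcases Finset.mem_union.1 hb with hb | hb
    · exact T₁.nonoverlapping a ha b hb
    · exact Or.inr (Or.inr (h.disjoint_of_le ((T₁.le_J ha ha).trans h₁)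
        ((T₂.le_J hb hb).trans h₂)))
    · exact Or.inr (Or.inr (h.symm.disjoint_of_le ((T₂.le_J ha ha).trans h₂)
        ((T₁.le_J hb hb).trans h₁)))
    · exact T₂.nonoverlapping a ha b hb
  J_inter G := by
    congr 1
    · rw [← T₁.J_inter, ← T₁.J_inter G, Finset.inter_assoc,
        Finset.inter_eq_right.2 Finset.subset_union_left]
    · rw [← T₂.J_inter, ← T₂.J_inter G, Finset.inter_assoc,
        Finset.inter_eq_right.2 Finset.subset_union_right]
  lowerType_J G hG := by
    rw [h.lowerType_join _ ((T₁.J_le_top _).trans h₁) _ ((T₂.J_le_top _).trans h₂),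
      ← T₁.J_inter, ← T₂.J_inter, T₁.lowerType_J _ Finset.inter_subset_right,
      T₂.lowerType_J _ Finset.inter_subset_right, ← h.prod_maximals_union,
      ← Finset.inter_union_distrib_left, Finset.inter_eq_left.2 hG]
    · intro a ha
      rw [Finset.mem_inter] at ha
      exact ⟨(T₁.le_J ha.2 ha.2).trans h₁, (T₁.isIrr a ha.2).ne_bot⟩
    · intro a ha
      rw [Finset.mem_inter] at ha
      exact ⟨(T₂.le_J ha.2 ha.2).trans h₂, (T₂.isIrr a ha.2).ne_bot⟩
  J_singleton a ha := by
    rcases Finset.mem_union.1 ha with ha | ha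
    · have hap := (T₁.le_J ha ha).trans h₁
      rw [T₁.J_singleton a ha, ← T₂.J_inter, Finset.singleton_inter_of_notMem, T₂.J_empty,
        h.join_bot a hap]
      exact fun h' => (T₁.isIrr a ha).ne_bot (h.disjoint hap ((T₂.le_J h' h').trans h₂))
    · have haq := (T₂.le_J ha ha).trans h₂
      rw [T₂.J_singleton a ha, ← T₁.J_inter, Finset.singleton_inter_of_notMem, T₁.J_empty,
        h.bot_join a haq]
      exact fun h' => (T₂.isIrr a ha).ne_bot (h.disjoint ((T₁.le_J h' h').trans h₁) haq)
  J_mono G' G hG := (h.join_le_join _ ((T₁.J_le_top _).trans h₁) _ ((T₂.J_le_top _).trans h₂)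
    _ ((T₁.J_le_top _).trans h₁) _ ((T₂.J_le_top _).trans h₂)).2
      ⟨T₁.J_mono _ _ hG, T₂.J_mono _ _ hG⟩

/-- The forest obtained by adding an irreducible element above all others. -/
noncomputable def insertTop {a : P.Elem} (ha : IsIrr a) (h : T.J T.F < a) : PreForest P where
  F := insert a T.F
  J G := if a ∈ G then a else T.J G
  isIrr b hb := by
    rcases Finset.mem_insert.1 hb with rfl | hb
    · exact ha
    · exact T.isIrr b hb
  nonoverlapping b hb c hc := by
    rw [Finset.mem_insert] at hb hc
    rcases hb with rfl | hb
    · refine Or.inr (Or.inl ?_)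
      rcases hc with rfl | hc
      · exact le_rfl
      · exact (T.le_J hc hc).trans h.le
    · rcases hc with rfl | hc
      · exact Or.inl ((T.le_J hb hb).trans h.le)
      · exact T.nonoverlapping b hb c hc
  J_inter G := by
    simp only [Finset.mem_inter, Finset.mem_insert_self, and_true]
    split_ifs with haG
    · rfl
    · rw [← T.J_inter, ← T.J_inter G, Finset.inter_assoc,
        Finset.inter_eq_right.2 (Finset.subset_insert _ _)]
  lowerType_J G hG := by
    split_ifs with haG
    · rw [maximals_eq_singleton haG, Finset.prod_singleton]
      intro b hb
      rcases Finset.mem_insert.1 (hG hb) with rfl | hb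
      · exact le_rfl
      · exact (T.le_J hb hb).trans h.le
    · exact T.lowerType_J G ((Finset.subset_insert_iff_of_notMem haG).1 hG)
  J_singleton b hb := by
    rcases Finset.mem_insert.1 hb with rfl | hb
    · simp
    · have : a ∉ ({b} : Finset P.Elem) := by
        rw [Finset.mem_singleton]
        rintro rfl
        exact absurd (T.le_J hb hb) h.not_ge
      rw [if_neg this, T.J_singleton b hb]
  J_mono G' G hG := by
    split_ifs with h1 h2 h2
    · exact le_rfl
    · exact absurd (hG h1) h2
    · exact (T.J_le_top _).trans h.le
    · exact T.J_mono _ _ hG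

theorem notMem_of_J_lt {a : P.Elem} (h : T.J T.F < a) : a ∉ T.F :=
  fun ha => absurd (T.le_J ha ha) h.not_ge

end PreForest

open IncidenceHopf (of)

/-! ### Predecessors, and decomposition of forests -/

theorem mem_predecessors {F : Finset P.Elem} {a b : P.Elem} :
    b ∈ predecessors F a ↔ b ∈ F ∧ b < a ∧ ∀ c ∈ F, ¬ (b < c ∧ c < a) := by
  classical
  unfold predecessors
  rw [Finset.mem_filter]
  unfold IsPredecessor
  tauto

theorem predecessors_eq_of_subset {F E : Finset P.Elem} {b : P.Elem} (hE : E ⊆ F)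
    (h : ∀ c ∈ F, c < b → c ∈ E) : predecessors E b = predecessors F b := by
  ext c
  rw [mem_predecessors, mem_predecessors]
  constructor
  · rintro ⟨h1, h2, h3⟩
    exact ⟨hE h1, h2, fun d hd hd' => h3 d (h d hd hd'.2) hd'⟩
  · rintro ⟨h1, h2, h3⟩
    exact ⟨h c h1 h2, h2, fun d hd hd' => h3 d (hE hd) hd'⟩

theorem predecessors_eq_maximals {F : Finset P.Elem} {a : P.Elem} (h : ∀ c ∈ F, c < a) :
    predecessors F a = maximals F := by
  ext c
  rw [mem_predecessors, mem_maximals]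
  constructor
  · rintro ⟨h1, -, h3⟩
    refine ⟨h1, fun d hd hcd => ?_⟩
    by_contra hdc
    exact h3 d hd ⟨lt_of_le_not_ge hcd hdc, h d hd⟩
  · rintro ⟨h1, h2⟩
    exact ⟨h1, h c h1, fun d hd hd' => hd'.1.not_ge (h2 d hd hd'.1.le)⟩

namespace PreForest

variable (T : PreForest P) {x p q : P.Elem} {j : P.Elem → P.Elem → P.Elem}

/-- The element `ã = J(predecessors of a)`. -/
noncomputable def tilde (a : P.Elem) : P.Elem := T.J (predecessors T.F a)

/-- Adding `a` to its predecessors gives a set with greatest element `a`, on which `J` takes the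
value `a`; then use monotonicity. -/
theorem tilde_le_of_mem {a : P.Elem} (ha : a ∈ T.F) : T.tilde a ≤ a := by
  have hsub : insert a (predecessors T.F a) ⊆ T.F :=
    Finset.insert_subset ha (predecessors_subset _ _)
  have : T.J (insert a (predecessors T.F a)) = a := by
    refine T.J_eq_of_greatest hsub (Finset.mem_insert_self _ _) fun b hb => ?_
    rcases Finset.mem_insert.1 hb with rfl | hb
    · exact le_rfl
    · exact (mem_predecessors.1 hb).2.1.le
  exact (T.J_mono _ _ (Finset.subset_insert _ _)).trans this.le

theorem tilde_le_of_isSplit (h : IsSplit x p q j) (hx : T.J T.F ≤ x) : T.tilde p ≤ p :=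
  T.J_le_left h (predecessors_subset _ _) ((T.J_le_top _).trans hx)
    fun _ hb => (mem_predecessors.1 hb).2.1.le

theorem tilde_eq_of_lt {a : P.Elem} (h : T.J T.F < a) : T.tilde a = T.J T.F := by
  rw [tilde, predecessors_eq_maximals fun c hc => (T.le_J hc hc).trans_lt h,
    T.J_maximals (Finset.Subset.refl _)]

/-- `ã` depends only on the part of the forest strictly below `a`. -/
theorem tilde_restrict {E : Finset P.Elem} {b : P.Elem} (h : ∀ c ∈ T.F, c < b → c ∈ E) :
    (T.restrict E).tilde b = T.tilde b := by
  have hpred : predecessors (T.F ∩ E) b = predecessors T.F b :=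
    predecessors_eq_of_subset Finset.inter_subset_left
      fun c hc hcb => Finset.mem_inter.2 ⟨hc, h c hc hcb⟩
  have : predecessors T.F b ⊆ E := by
    rw [← hpred]
    exact (predecessors_subset _ _).trans Finset.inter_subset_right
  change T.J (predecessors (T.F ∩ E) b ∩ E) = T.J (predecessors T.F b)
  rw [hpred, Finset.inter_eq_left.2 this]

theorem restrict_J_F (E : Finset P.Elem) : (T.restrict E).J (T.restrict E).F = T.J E := by
  change T.J (T.F ∩ E ∩ E) = T.J E
  rw [Finset.inter_assoc, Finset.inter_self, Finset.inter_comm, T.J_inter]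

theorem restrict_J_F_le (h : IsSplit x p q j) (hx : T.J T.F ≤ x) :
    (T.restrict (below p)).J (T.restrict (below p)).F ≤ p := by
  rw [restrict_J_F]
  have := T.J_inter_below_le h hx (below p)
  rwa [Finset.inter_self] at this

theorem restrict_join_left (h : IsSplit x p q j) (T₁ T₂ : PreForest P) (h₁ : T₁.J T₁.F ≤ p)
    (h₂ : T₂.J T₂.F ≤ q) : (join h T₁ T₂ h₁ h₂).restrict (below p) = T₁ := by
  have hF₂ : T₂.F ∩ below p = ∅ := by
    rw [Finset.eq_empty_iff_forall_notMem]
    intro a ha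
    rw [Finset.mem_inter, mem_below] at ha
    exact (T₂.isIrr a ha.1).ne_bot (h.disjoint ha.2 ((T₂.le_J ha.1 ha.1).trans h₂))
  have hF₁ : T₁.F ∩ below p = T₁.F := by
    rw [Finset.inter_eq_left]
    intro a ha
    exact mem_below.2 ((T₁.le_J ha ha).trans h₁)
  refine PreForest.ext ?_ (funext fun G => ?_)
  · change (T₁.F ∪ T₂.F) ∩ below p = T₁.F
    rw [Finset.union_inter_distrib_right, hF₁, hF₂, Finset.union_empty]
  · change j (T₁.J (G ∩ below p)) (T₂.J (G ∩ below p)) = T₁.J G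
    rw [← T₂.J_inter, Finset.inter_assoc, Finset.inter_comm (below p), hF₂, Finset.inter_empty,
      T₂.J_empty, h.join_bot _ ((T₁.J_le_top _).trans h₁), ← T₁.J_inter, Finset.inter_assoc,
      Finset.inter_comm (below p), hF₁, T₁.J_inter]

theorem join_comm (h : IsSplit x p q j) (T₁ T₂ : PreForest P) (h₁ : T₁.J T₁.F ≤ p)
    (h₂ : T₂.J T₂.F ≤ q) : join h.symm T₂ T₁ h₂ h₁ = join h T₁ T₂ h₁ h₂ :=
  PreForest.ext (Finset.union_comm _ _) rfl

theorem restrict_join_right (h : IsSplit x p q j) (T₁ T₂ : PreForest P) (h₁ : T₁.J T₁.F ≤ p)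
    (h₂ : T₂.J T₂.F ≤ q) : (join h T₁ T₂ h₁ h₂).restrict (below q) = T₂ := by
  rw [← join_comm, restrict_join_left]

theorem F_eq_union (h : IsSplit x p q j) (hx : T.J T.F ≤ x) :
    T.F ∩ below p ∪ T.F ∩ below q = T.F := by
  rw [← Finset.inter_union_distrib_left, Finset.inter_eq_left]
  intro b hb
  rw [Finset.mem_union, mem_below, mem_below]
  exact T.le_or_le h hx hb

theorem join_restrict (h : IsSplit x p q j) (hx : T.J T.F ≤ x) :
    join h (T.restrict (below p)) (T.restrict (below q)) (T.restrict_J_F_le h hx)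
      (T.restrict_J_F_le h.symm hx) = T :=
  PreForest.ext (T.F_eq_union h hx) (funext fun G => (T.J_eq_join h hx G).symm)

theorem join_J_F (h : IsSplit x p q j) (T₁ T₂ : PreForest P) (h₁ : T₁.J T₁.F ≤ p)
    (h₂ : T₂.J T₂.F ≤ q) : (join h T₁ T₂ h₁ h₂).J (join h T₁ T₂ h₁ h₂).F ≤ x :=
  h.join_le _ ((T₁.J_le_top _).trans h₁) _ ((T₂.J_le_top _).trans h₂)

open Classical in
/-- Forests below a product are pairs of forests below the factors. -/
theorem sum_join {M : Type*} [AddCommMonoid M] (h : IsSplit x p q j)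
    (f : PreForest P → PreForest P → M) :
    ∑ T : PreForest P with T.J T.F ≤ x, f (T.restrict (below p)) (T.restrict (below q)) =
      ∑ T₁ : PreForest P with T₁.J T₁.F ≤ p, ∑ T₂ : PreForest P with T₂.J T₂.F ≤ q, f T₁ T₂ := by
  rw [← Finset.sum_product']
  refine Finset.sum_bij' (fun T _ => (T.restrict (below p), T.restrict (below q)))
    (fun T hT => join h T.1 T.2 (Finset.mem_filter.1 (Finset.mem_product.1 hT).1).2
      (Finset.mem_filter.1 (Finset.mem_product.1 hT).2).2) ?_ ?_ ?_ ?_ ?_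
  · intro T hT
    have hT := (Finset.mem_filter.1 hT).2
    simp only [Finset.mem_product, Finset.mem_filter, Finset.mem_univ, true_and]
    exact ⟨T.restrict_J_F_le h hT, T.restrict_J_F_le h.symm hT⟩
  · intro T hT
    exact Finset.mem_filter.2 ⟨Finset.mem_univ _, join_J_F h _ _ _ _⟩
  · intro T hT
    exact T.join_restrict h (Finset.mem_filter.1 hT).2
  · intro T hT
    exact Prod.ext (restrict_join_left h _ _ _ _) (restrict_join_right h _ _ _ _)
  · intro T hT
    rfl

theorem insertTop_restrict {a : P.Elem} (ha : IsIrr a) (h : T.J T.F < a) :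
    (T.insertTop ha h).restrict T.F = T := by
  have haF := T.notMem_of_J_lt h
  refine PreForest.ext ?_ (funext fun G => ?_)
  · change insert a T.F ∩ T.F = T.F
    exact Finset.inter_eq_right.2 (Finset.subset_insert _ _)
  · change (if a ∈ G ∩ T.F then a else T.J (G ∩ T.F)) = T.J G
    rw [if_neg (fun h => haF (Finset.mem_inter.1 h).2), T.J_inter]

theorem insertTop_J_F {a : P.Elem} (ha : IsIrr a) (h : T.J T.F < a) :
    (T.insertTop ha h).J (T.insertTop ha h).F = a :=
  if_pos (Finset.mem_insert_self _ _)

/-- If the value stayed `a`, the irreducible `a` would belong to the set from which it was erased.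
-/
theorem restrict_erase_J_F_lt {a : P.Elem} (ha : IsIrr a) (h : T.J T.F = a) :
    (T.restrict (T.F.erase a)).J (T.restrict (T.F.erase a)).F < a := by
  rw [restrict_J_F]
  refine lt_of_le_of_ne (h ▸ T.J_le_top _) fun h' => ?_
  exact Finset.notMem_erase a T.F (T.mem_of_J_eq (Finset.erase_subset _ _) ha h')

theorem restrict_insertTop {a : P.Elem} (ha : IsIrr a) (h : T.J T.F = a) :
    (T.restrict (T.F.erase a)).insertTop ha (T.restrict_erase_J_F_lt ha h) = T := by
  have haF := T.mem_of_J_eq (Finset.Subset.refl _) ha h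
  refine PreForest.ext ?_ (funext fun G => ?_)
  · change insert a (T.F ∩ T.F.erase a) = T.F
    rw [Finset.inter_eq_right.2 (Finset.erase_subset _ _), Finset.insert_erase haF]
  · change (if a ∈ G then a else T.J (G ∩ T.F.erase a)) = T.J G
    split_ifs with haG
    · exact le_antisymm (T.le_J haF haG) ((T.J_le_top _).trans h.le)
    · rw [Finset.inter_erase, Finset.erase_eq_of_notMem, T.J_inter]
      exact fun h => haG (Finset.mem_inter.1 h).1

/-! ### Weights of forests and the antipode -/

section Weight

variable (k : Type v) [CommRing k]

/-- The signed product of the intervals `[ã, a]` over `a ∈ F ∪ D`. -/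
noncomputable def weight (D : Finset P.Elem) : IncidenceHopf k 𝓕 :=
  (-1) ^ T.F.card * ∏ a ∈ T.F ∪ D, of k (itvType P (T.tilde a) a)

theorem weight_of_subset {D : Finset P.Elem} (hD : D ⊆ T.F) : T.weight k D = T.weight k ∅ := by
  rw [weight, weight, Finset.union_eq_left.2 hD, Finset.union_empty]

theorem weight_singleton {a : P.Elem} (h : T.J T.F < a) :
    T.weight k {a} = T.weight k ∅ * of k (itvType P (T.J T.F) a) := by
  rw [weight, weight, Finset.union_empty, Finset.union_comm, ← Finset.insert_eq,
    Finset.prod_insert (T.notMem_of_J_lt h), T.tilde_eq_of_lt h]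
  ring

/-- The new element contributes a sign and the factor `[J F, a]`. It lies above all others, so their
`ã` do not change. -/
theorem weight_insertTop {a : P.Elem} (ha : IsIrr a) (h : T.J T.F < a) :
    (T.insertTop ha h).weight k ∅ = -(T.weight k ∅ * of k (itvType P (T.J T.F) a)) := by
  have haF := T.notMem_of_J_lt h
  have htilde : ∀ b ≤ a, (T.insertTop ha h).tilde b = T.tilde b := fun b hb => by
    rw [← tilde_restrict (E := T.F), insertTop_restrict]
    intro c hc hcb
    rcases Finset.mem_insert.1 hc with rfl | hc
    · exact absurd hb hcb.not_ge
    · exact hc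
  have hF : (T.insertTop ha h).F = insert a T.F := rfl
  rw [weight, weight, Finset.union_empty, Finset.union_empty, hF, Finset.prod_insert haF,
    Finset.card_insert_of_notMem haF, htilde a le_rfl, T.tilde_eq_of_lt h,
    Finset.prod_congr rfl fun b hb => by rw [htilde b ((T.le_J hb hb).trans h.le)]]
  ring

/-- `F` is the disjoint union of its parts below `p` and `q`, and all predecessors of an element lie
in the same part. -/
theorem weight_union (h : IsSplit x p q j) (hx : T.J T.F ≤ x) {A B : Finset P.Elem}
    (hA : ∀ a ∈ A, a ≤ p ∧ a ≠ ⊥) (hB : ∀ b ∈ B, b ≤ q ∧ b ≠ ⊥) :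
    T.weight k (A ∪ B) =
      (T.restrict (below p)).weight k A * (T.restrict (below q)).weight k B := by
  have hF : ∀ r, (T.restrict (below r)).F = T.F ∩ below r := fun _ => rfl
  have hmem : ∀ r, ∀ a ∈ T.F ∩ below r, a ≤ r ∧ a ≠ ⊥ := fun r a ha => by
    rw [Finset.mem_inter, mem_below] at ha
    exact ⟨ha.2, (T.isIrr a ha.1).ne_bot⟩
  have htilde : ∀ r, ∀ b ≤ r, (T.restrict (below r)).tilde b = T.tilde b := fun r b hb =>
    T.tilde_restrict fun c _ hcb => mem_below.2 (hcb.le.trans hb)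
  have hpA : ∀ a ∈ T.F ∩ below p ∪ A, a ≤ p ∧ a ≠ ⊥ := fun a ha =>
    (Finset.mem_union.1 ha).elim (hmem p a) (hA a)
  have hqB : ∀ a ∈ T.F ∩ below q ∪ B, a ≤ q ∧ a ≠ ⊥ := fun a ha =>
    (Finset.mem_union.1 ha).elim (hmem q a) (hB a)
  have hunion : T.F ∪ (A ∪ B) = (T.F ∩ below p ∪ A) ∪ (T.F ∩ below q ∪ B) := by
    conv_lhs => rw [← T.F_eq_union h hx]
    exact Finset.union_union_union_comm _ _ _ _
  have hcard : T.F.card = (T.F ∩ below p).card + (T.F ∩ below q).card := by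
    conv_lhs => rw [← T.F_eq_union h hx]
    exact Finset.card_union_of_disjoint
      (h.disjoint_finset (hmem p) fun b hb => (hmem q b hb).1)
  rw [weight, weight, weight, hF, hF, hunion,
    Finset.prod_union (h.disjoint_finset hpA fun b hb => (hqB b hb).1), hcard, pow_add,
    Finset.prod_congr rfl fun b hb => by rw [← htilde p b (hpA b hb).1],
    Finset.prod_congr (s₁ := T.F ∩ below q ∪ B) rfl fun b hb => by
      rw [← htilde q b (hqB b hb).1]]
  ring

open Classical in
/-- The sum of the weights of the forests with `J(F) = x`. -/
noncomputable def weightSum (x : P.Elem) : IncidenceHopf k 𝓕 :=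
  ∑ T : PreForest P with T.J T.F = x, T.weight k ∅

theorem weightSum_bot : weightSum k (⊥ : P.Elem) = 1 := by
  classical
  let T₀ : PreForest P :=
    { F := ∅
      J := fun _ => ⊥
      isIrr := by simp
      nonoverlapping := by simp
      J_inter := fun _ => rfl
      lowerType_J := fun G hG => by
        rw [Finset.subset_empty.1 hG, maximals_empty, Finset.prod_empty, lowerType_bot]
      J_singleton := by simp
      J_mono := fun _ _ _ => le_rfl }
  unfold weightSum
  rw [Finset.sum_eq_single T₀]
  · simp [weight, T₀]
  · intro T hT hne
    refine absurd ?_ hne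
    have hT := (Finset.mem_filter.1 hT).2
    refine PreForest.ext (Finset.eq_empty_iff_forall_notMem.2 fun a ha => ?_)
      (funext fun G => ?_)
    · exact (T.isIrr a ha).ne_bot (le_bot_iff.1 ((T.le_J ha ha).trans hT.le))
    · exact le_bot_iff.1 ((T.J_le_top G).trans hT.le)
  · intro h
    exact (h (Finset.mem_filter.2 ⟨Finset.mem_univ _, rfl⟩)).elim

open Classical in
-- Inserting `a` on top and erasing it are inverse bijections between the forests with `J F < a` and
-- those with `J F = a`.
theorem weightSum_of_isIrr {a : P.Elem} (ha : IsIrr a) : weightSum k a =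
    -∑ T : PreForest P with T.J T.F < a, T.weight k ∅ * of k (itvType P (T.J T.F) a) := by
  unfold weightSum
  rw [← Finset.sum_neg_distrib]
  symm
  refine Finset.sum_bij' (fun T hT => T.insertTop ha (Finset.mem_filter.1 hT).2)
    (fun T _ => T.restrict (T.F.erase a)) ?_ ?_ ?_ ?_ ?_
  · intro T hT
    exact Finset.mem_filter.2 ⟨Finset.mem_univ _, T.insertTop_J_F ha _⟩
  · intro T hT
    exact Finset.mem_filter.2 ⟨Finset.mem_univ _,
      T.restrict_erase_J_F_lt ha (Finset.mem_filter.1 hT).2⟩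
  · intro T hT
    have hT := (Finset.mem_filter.1 hT).2
    have hF : (T.insertTop ha hT).F.erase a = T.F := Finset.erase_insert (T.notMem_of_J_lt hT)
    rw [hF, insertTop_restrict]
  · intro T hT
    exact T.restrict_insertTop ha (Finset.mem_filter.1 hT).2
  · intro T hT
    exact (T.weight_insertTop k ha _).symm

open Classical in
/-- The forests that contain the irreducible element `a` cancel those that do not. -/
theorem sum_weight_singleton {a : P.Elem} (ha : IsIrr a) :
    ∑ T : PreForest P with T.J T.F ≤ a, T.weight k {a} = 0 := by
  have hsplit : (Finset.univ.filter fun T : PreForest P => T.J T.F ≤ a) =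
      (Finset.univ.filter fun T : PreForest P => T.J T.F = a) ∪
        Finset.univ.filter fun T : PreForest P => T.J T.F < a := by
    ext T
    simp only [Finset.mem_filter, Finset.mem_univ, true_and, Finset.mem_union]
    exact le_iff_eq_or_lt
  have hdisj : Disjoint (Finset.univ.filter fun T : PreForest P => T.J T.F = a)
      (Finset.univ.filter fun T : PreForest P => T.J T.F < a) := by
    rw [Finset.disjoint_filter]
    exact fun T _ h h' => h'.ne h
  rw [hsplit, Finset.sum_union hdisj, add_eq_zero_iff_eq_neg]
  -- If `J F = a` then `a ∈ F` and adjoining `a` changes nothing; if `J F < a` it adds the factor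
  -- `[J F, a]`, as insertion of `a` does up to sign.
  refine Eq.trans ?_ ((weightSum_of_isIrr k ha).trans (congrArg _ ?_))
  · refine Finset.sum_congr rfl fun T hT => T.weight_of_subset k ?_
    exact Finset.singleton_subset_iff.2
      (T.mem_of_J_eq (Finset.Subset.refl _) ha (Finset.mem_filter.1 hT).2)
  · exact Finset.sum_congr rfl fun T hT => (T.weight_singleton k (Finset.mem_filter.1 hT).2).symm

theorem weightSum_of_isSplit (h : IsSplit x p q j) :
    weightSum k x = weightSum k p * weightSum k q := by
  classical
  -- The indicator cuts the sum over forests below `x` down to those that reach `x`, that is, whose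
  -- two parts reach `p` and `q`.
  have key := sum_join h fun T₁ T₂ => if T₁.J T₁.F = p ∧ T₂.J T₂.F = q then
    T₁.weight k ∅ * T₂.weight k ∅ else 0
  have hfil : ∀ y : P.Elem, weightSum k y = ∑ T : PreForest P with T.J T.F ≤ y,
      if T.J T.F = y then T.weight k ∅ else 0 := fun y => by
    rw [weightSum, ← Finset.sum_filter, Finset.filter_filter]
    refine Finset.sum_congr (Finset.filter_congr fun T _ => ?_) fun _ _ => rfl
    exact ⟨fun h => ⟨h.le, h⟩, fun h => h.2⟩
  rw [hfil x, hfil p, hfil q, Finset.sum_mul_sum]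
  refine Eq.trans (Finset.sum_congr rfl fun T hT => ?_) (key.trans ?_)
  · have hT := (Finset.mem_filter.1 hT).2
    have hiff : T.J T.F = x ↔ (T.restrict (below p)).J (T.restrict (below p)).F = p ∧
        (T.restrict (below q)).J (T.restrict (below q)).F = q := by
      rw [restrict_J_F, restrict_J_F, T.J_eq_join h hT, ← T.J_inter (below p),
        ← T.J_inter (below q), Finset.inter_comm (below p), Finset.inter_comm (below q)]
      constructor
      · intro h'
        exact h.join_inj (T.J_inter_below_le h hT _) (T.J_inter_below_le h.symm hT _) le_rfl le_rfl
          (h'.trans h.join_top.symm)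
      · rintro ⟨h1, h2⟩
        rw [h1, h2, h.join_top]
    by_cases hJ : T.J T.F = x
    · rw [if_pos hJ, if_pos (hiff.1 hJ), ← T.weight_union k h hT (by simp) (by simp),
        Finset.union_empty]
    · rw [if_neg hJ, if_neg (fun h => hJ (hiff.2 h))]
  · refine Finset.sum_congr rfl fun T₁ _ => Finset.sum_congr rfl fun T₂ _ => ?_
    rw [ite_zero_mul_ite_zero]

open Classical in
-- The identity χ * id = ηε evaluated at `[⊥, x]`, where the counit vanishes.
theorem sum_antipode_lower {x : P.Elem} (hx : x ≠ ⊥) :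
    ∑ y : P.Elem with y ≤ x, HopfAlgebra.antipode k (of k (lowerType y)) *
      of k (itvType P y x) = 0 := by
  have h := HopfAlgebra.mul_antipode_rTensor_comul_apply (R := k) (of k (type (P.lower x)))
  rw [IncidenceHopf.comul_of, IncidenceHopf.counit_of, type_lower,
    if_neg (fun h => hx (lowerType_eq_one_iff.1 h)), map_zero, map_sum, map_sum] at h
  refine Eq.trans ?_ h
  have := sum_itv P (bot_le : ⊥ ≤ x) fun y => HopfAlgebra.antipode k (of k (lowerType y)) *
      of k (itvType P y x)
  simp only [bot_le, true_and] at this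
  rw [← this]
  refine Finset.sum_congr rfl fun z _ => ?_
  rw [LinearMap.rTensor_tmul, LinearMap.mul'_apply, itvType_itv, itvType_itv, incl_top, incl_bot]
  rfl

/-- The sum of the weights of the forests with `J(F) = x` is the antipode of `[0, x]`. -/
theorem weightSum_eq_antipode (x : P.Elem) :
    weightSum k x = HopfAlgebra.antipode k (of k (lowerType x)) := by
  classical
  induction x using WellFoundedLT.induction with
  | _ x ih =>
  rcases eq_bot_or_isIrr_or_exists_isSplit x with rfl | hx | ⟨p, q, j, h, hp, hq⟩
  · rw [weightSum_bot, lowerType_bot, map_one, HopfAlgebra.antipode_one]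
  · have h := sum_antipode_lower k hx.ne_bot
    have hsplit : (Finset.univ.filter fun y : P.Elem => y ≤ x) =
        insert x (Finset.univ.filter fun y : P.Elem => y < x) := by
      ext y
      simp [le_iff_eq_or_lt]
    rw [hsplit, Finset.sum_insert (by simp), itvType_self, map_one, mul_one,
      add_eq_zero_iff_eq_neg] at h
    rw [weightSum_of_isIrr k hx, h, neg_inj]
    have hmaps : ∀ T ∈ Finset.univ.filter (fun T : PreForest P => T.J T.F < x),
        T.J T.F ∈ Finset.univ.filter (fun y : P.Elem => y < x) := fun T hT => by
      simpa using hT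
    -- Grouping forests by `y = J F` turns the recursion for `weightSum` into that of the antipode.
    rw [← Finset.sum_fiberwise_of_maps_to hmaps]
    refine Finset.sum_congr rfl fun y hy => ?_
    have hy := (Finset.mem_filter.1 hy).2
    rw [← ih y hy, weightSum, Finset.sum_mul, Finset.filter_filter]
    refine Finset.sum_congr (Finset.filter_congr fun T _ => ?_) fun T hT => ?_
    · exact ⟨fun h => h.2, fun h => ⟨h ▸ hy, h⟩⟩
    · rw [(Finset.mem_filter.1 hT).2]
  · rw [weightSum_of_isSplit k h, ih p hp, ih q hq, h.lowerType_eq, map_mul,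
      HopfAlgebra.antipode_mul_distrib]

/-- The sum of the weights of all forests, with the prime center adjoined, vanishes. -/
theorem sum_weight_primeCenter (hP : ¬ P.IsPoint) :
    ∑ T : PreForest P, T.weight k (primeCenter P) = 0 := by
  classical
  obtain ⟨E, hE⟩ := exists_isFactorSet (⊤ : P.Elem)
  obtain ⟨a, ha⟩ := primeCenter_nonempty hP
  have hsub := primeCenter_subset_of_isFactorSet hE
  obtain ⟨q, j, h⟩ := hE.exists_isSplit a (hsub ha)
  have hirr := hE.isIrr a (hsub ha)
  have hA : ∀ b ∈ ({a} : Finset P.Elem), b ≤ a ∧ b ≠ ⊥ := fun b hb => by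
    rw [Finset.mem_singleton.1 hb]
    exact ⟨le_rfl, hirr.ne_bot⟩
  have hB : ∀ b ∈ (primeCenter P).erase a, b ≤ q ∧ b ≠ ⊥ := fun b hb => by
    rw [Finset.mem_erase] at hb
    have hb' := hE.isIrr b (hsub hb.2)
    refine ⟨(h.le_or_le hb' le_top).resolve_left fun hba => hb'.ne_bot ?_, hb'.ne_bot⟩
    exact le_bot_iff.1 (hE.disjoint b (hsub hb.2) a (hsub ha) hb.1 le_rfl hba)
  -- One prime central `a` suffices: the total is a product whose factor from `[⊥, a]` is zero,
  -- while the remaining prime center lies below the complement `q`.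
  have key := sum_join h fun T₁ T₂ => T₁.weight k {a} * T₂.weight k ((primeCenter P).erase a)
  rw [← Finset.sum_mul_sum, sum_weight_singleton k hirr, zero_mul] at key
  refine Eq.trans ?_ key
  rw [Finset.filter_true_of_mem fun _ _ => le_top]
  refine Finset.sum_congr rfl fun T _ => ?_
  rw [← T.weight_union k h le_top hA hB, ← Finset.insert_eq, Finset.insert_erase ha]

end Weight

/-! ### Return to the forests of `P` -/

theorem tilde_le_of_mem_primeCenter {a : P.Elem} (ha : a ∈ primeCenter P) : T.tilde a ≤ a := by
  obtain ⟨E, hE⟩ := exists_isFactorSet (⊤ : P.Elem)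
  obtain ⟨q, j, h⟩ := hE.exists_isSplit a (primeCenter_subset_of_isFactorSet hE ha)
  exact T.tilde_le_of_isSplit h le_top

/-- When `J F = ⊤`, the maximal elements of `F` are all the irreducible factors of `⊤`, and the
prime center consists of such factors. -/
theorem primeCenter_subset (h : T.J T.F = ⊤) : primeCenter P ⊆ T.F := by
  obtain ⟨E, hE⟩ := exists_isFactorSet (⊤ : P.Elem)
  have := T.maximals_eq (Finset.Subset.refl _) (h.symm ▸ hE)
  exact (primeCenter_subset_of_isFactorSet hE).trans (this ▸ maximals_subset _)

/-- A forest, as a forest in the wider sense. -/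
noncomputable def ofForest (T : Forest P) : PreForest P where
  F := T.F
  J G := T.J ⟨G ∩ T.F, Finset.inter_subset_right⟩
  isIrr a ha := by
    have := T.mem_indecomposables a ha
    exact isIrr_iff.2 ⟨this.1, this.2.2⟩
  nonoverlapping a ha b hb := by
    refine (T.nonoverlapping a ha b hb).imp_right (Or.imp_right fun h w hwa hwb => ?_)
    have : w ∈ Set.Icc ⊥ a ∩ Set.Icc ⊥ b := ⟨⟨bot_le, hwa⟩, ⟨bot_le, hwb⟩⟩
    rw [h] at this
    exact le_of_eq this
  J_inter G := by
    congr 2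
    rw [Finset.inter_assoc, Finset.inter_self]
  lowerType_J G hG := by
    rw [← type_lower, T.type_J]
    refine Finset.prod_congr ?_ fun a _ => type_lower P a
    exact congrArg maximals (Finset.inter_eq_left.2 hG)
  J_singleton a ha := by
    have h : {a} ⊆ T.F := Finset.singleton_subset_iff.2 ha
    refine Eq.trans (congrArg T.J (Subtype.ext ?_)) (T.J_singleton a h)
    exact Finset.inter_eq_left.2 h
  J_mono G' G hG := T.J_mono _ _ (Finset.inter_subset_inter_right hG)

/-- A forest in the wider sense, as a forest, if `J` does not attain the greatest element. -/
noncomputable def toForest (h : T.J T.F ≠ ⊤) : Forest P where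
  F := T.F
  J G := T.J G
  mem_indecomposables a ha := by
    have := isIrr_iff.1 (T.isIrr a ha)
    refine ⟨this.1, ?_, this.2⟩
    rintro rfl
    exact h (top_le_iff.1 (T.le_J ha ha))
  J_ne_top G h' := h (top_le_iff.1 (h' ▸ T.J_le_top _))
  J_singleton a ha := T.J_singleton a (Finset.singleton_subset_iff.1 ha)
  nonoverlapping a ha b hb := by
    refine (T.nonoverlapping a ha b hb).imp_right (Or.imp_right fun h => ?_)
    ext w
    simp only [Set.mem_inter_iff, Set.mem_Icc, bot_le, true_and, Set.mem_singleton_iff]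
    exact ⟨fun hw => le_bot_iff.1 (h hw.1 hw.2), by rintro rfl; simp⟩
  type_J G := by
    rw [type_lower, T.lowerType_J _ G.2]
    exact Finset.prod_congr rfl fun a _ => (type_lower P a).symm
  J_mono G' G hG := T.J_mono _ _ hG

theorem tilde_ofForest (T : Forest P) (a : P.Elem) : (ofForest T).tilde a = T.tilde a :=
  congrArg T.J (Subtype.ext (Finset.inter_eq_left.2 (predecessors_subset T.F a)))

theorem weight_ofForest (k : Type v) [CommRing k] (T : Forest P) :
    -(ofForest T).weight k (primeCenter P) = (-1) ^ T.d * of k T.theta := by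
  have hF : (ofForest T).F = T.F := rfl
  rw [weight, hF, Forest.d, Forest.theta, map_prod, pow_succ,
    Finset.prod_congr rfl fun a _ => by rw [tilde_ofForest]]
  ring

open Classical in
-- Since `J` is monotone, avoiding `⊤` at `F` means avoiding it everywhere and keeps `⊤` out of `F`,
-- as a forest of `P` requires.
theorem sum_forest (k : Type v) [CommRing k] :
    ∑ T : Forest P, (-1) ^ T.d * of k T.theta =
      -∑ T : PreForest P with ¬ T.J T.F = ⊤, T.weight k (primeCenter P) := by
  rw [← Finset.sum_neg_distrib]
  refine Finset.sum_bij' (fun T _ => ofForest T)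
    (fun T hT => T.toForest (Finset.mem_filter.1 hT).2) ?_ ?_ ?_ ?_ ?_
  · intro T _
    exact Finset.mem_filter.2 ⟨Finset.mem_univ _, T.J_ne_top _⟩
  · intro T _
    exact Finset.mem_univ _
  · intro T _
    obtain ⟨F, J, _, _, _, _, _, _⟩ := T
    simp only [toForest, ofForest]
    congr 1
    funext G
    exact congrArg J (Subtype.ext (Finset.inter_eq_left.2 G.2))
  · intro T _
    exact PreForest.ext rfl (funext fun G => T.J_inter G)
  · intro T _
    exact (weight_ofForest k T).symm

end PreForest

end HereditaryFamily

theorem mainTheorem2 {k : Type v} [CommRing k] {α : Type u} (𝓕 : HereditaryFamily α)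
    (P : 𝓕.Obj) (hP : ¬ P.IsPoint) :
    (∀ T : HereditaryFamily.Forest P, ∀ a ∈ T.F ∪ HereditaryFamily.primeCenter P,
      T.tilde a ≤ a) ∧
    HopfAlgebra.antipode k (IncidenceHopf.of k (HereditaryFamily.type P)) =
      ∑ T : HereditaryFamily.Forest P, (-1) ^ T.d * IncidenceHopf.of k T.theta := by
  classical
  open HereditaryFamily PreForest in
  refine ⟨fun T a ha => ?_, ?_⟩
  · rw [← tilde_ofForest]
    rcases Finset.mem_union.1 ha with ha | ha
    · exact (ofForest T).tilde_le_of_mem ha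
    · exact (ofForest T).tilde_le_of_mem_primeCenter ha
  -- Split the vanishing total by whether `J F = ⊤`: that part is the antipode of `P`, the rest is
  -- minus the sum over forests.
  · have h := sum_weight_primeCenter (P := P) k hP
    rw [← Finset.sum_filter_add_sum_filter_not _ fun T : PreForest P => T.J T.F = ⊤,
      add_eq_zero_iff_eq_neg] at h
    rw [sum_forest, ← itvType_bot_top]
    refine (weightSum_eq_antipode k (⊤ : P.Elem)).symm.trans (Eq.trans ?_ h)
    refine Finset.sum_congr rfl fun T hT => (T.weight_of_subset k ?_).symm
    exact T.primeCenter_subset (Finset.mem_filter.1 hT).2
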